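/- Let $\mathbb{K}$ be an algebraically closed field and let $n\ge 1$ and $h>1$ be integers. Let $\Delta_n$ be the linear quiver $1\to 2\to\dots\to n$ and $\tilde\Delta_n$ the cyclic quiver $1\to 2\to\dots\to n\to 1$; put $A_n^h=\mathbb{K}\Delta_n/R^h$ and $\tilde A_n^h=\mathbb{K}\tilde\Delta_n/R^h$, where $R$ is the arrow ideal of the respective path algebra. Modules are left modules, and paths are multiplied in such a way that $P_i=Ae_i$ is spanned by the paths starting at $i$. For a set $\Sigma$ of maps between finitely generated projective $A$-modules, the universal localisation $A\to A_\Sigma$ is the universal ring homomorphism $f\colon A\to B$ such that $B\otimes_A\sigma$ is an isomorphism for all $\sigma\in\Sigma$. Two universal localisations $f\colon A\to B$ and $g\colon A\to C$ lie in the same epiclass if $g=\varphi f$ for some ring isomorphism $\varphi\colon B\to C$. Consider $n$ points $1,\dots,n$, either on a line or, cyclically ordered, on an oriented circle. An arc is an ordered pair $(j,i)$ of points, on the line with $j\le i$; it is called a loop if $j=i$. Its length is the number of steps from $j$ to $i$ in the direction of the orientation, that is, $i-j$ on the line and the residue of $i-j$ modulo $n$ in $\{0,\dots,n-1\}$ on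 the circle; so a loop has length $0$. The arc covers the points that are met on the way from $j$ to $i$ in the direction of the orientation, including the end points $j$ and $i$. A set of arcs is a non-crossing configuration if any two different arcs in it are either completely separated (no point is covered by both) or properly nested (all points covered by one of them lie strictly between the end points of the other). 1. There is a bijection between the epiclasses of universal localisations of $A_n^h$ and the non-crossing configurations of arcs of length at most $\min\{n-1,h-1\}$ on a line with $n$ points. 2. There is a bijection between the epiclasses of universal localisations of $\tilde A_n^h$ and the non-crossing configurations of arcs of length at most $\min\{n-1,h-1\}$ on a circle with $n$ points. In both cases the bijection can be chosen as follows. Write $A$ for the algebra. Given a universal localisation $A\to A_\Sigma$, call $j$ linked to $i$ if there is a path from $j$ to $i$ such that $A_\Sigma\otimes_A-$ turns the induced map $P_i\to P_j$ into an isomorphism. The configuration of $A_\Sigma$ contains the arc $(j,i)$ with $j\ne i$ if and only if $A_\Sigma\otimes_A P_j\ne 0$, $j$ is linked to $i$, no $x\neq j$ is linked to $j$, and $i$ is linked to no $y\ne i$. It contains the loop at $k$ if and only if $A_\Sigma\otimes_A P_k=0$, or some $x\ne k$ is linked to $k$ and $k$ is linked to some $y\neq k$. -/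

import Mathlib

open scoped TensorProduct

universe u

/-! ### Extension of scalars and universal localisation over noncommutative rings -/

section Localisation

variable {A B C : Type u} [Ring A] [Ring B] [Ring C]

/-- The `B`-submodule of `B ⊗[ℤ] M` generated by all `b f(a) ⊗ m - b ⊗ a m`. -/
def balancedRel (f : A →+* B) (M : Type u) [AddCommGroup M] [Module A M] :
    Submodule B (B ⊗[ℤ] M) :=
  Submodule.span B
    {z | ∃ (b : B) (a : A) (m : M), z = (b * f a) ⊗ₜ[ℤ] m - b ⊗ₜ[ℤ] (a • m)}

/-- The left `B`-module `B ⊗_A M`, where `B` is a right `A`-module through `f`. -/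
abbrev BaseChange (f : A →+* B) (M : Type u) [AddCommGroup M] [Module A M] : Type u :=
  (B ⊗[ℤ] M) ⧸ balancedRel f M

/-- The `B`-linear map `B ⊗_A φ : B ⊗_A M → B ⊗_A N`. -/
def BaseChange.map (f : A →+* B) {M N : Type u} [AddCommGroup M] [Module A M]
    [AddCommGroup N] [Module A N] (φ : M →ₗ[A] N) : BaseChange f M →ₗ[B] BaseChange f N :=
  Submodule.mapQ (balancedRel f M) (balancedRel f N)
    (TensorProduct.AlgebraTensorModule.map (LinearMap.id : B →ₗ[B] B)
      φ.toAddMonoidHom.toIntLinearMap) (by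
    rw [balancedRel, Submodule.span_le]
    rintro _ ⟨b, a, m, rfl⟩
    refine Submodule.subset_span ⟨b, a, φ m, ?_⟩
    simp)

/-- A map between finitely generated projective left `A`-modules. -/
structure ProjMap (A : Type u) [Ring A] : Type (u + 1) where
  P : Type u
  Q : Type u
  [addCommGroupP : AddCommGroup P]
  [addCommGroupQ : AddCommGroup Q]
  [moduleP : Module A P]
  [moduleQ : Module A Q]
  [finiteP : Module.Finite A P]
  [finiteQ : Module.Finite A Q]
  [projectiveP : Module.Projective A P]
  [projectiveQ : Module.Projective A Q]
  hom : P →ₗ[A] Q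

attribute [instance] ProjMap.addCommGroupP ProjMap.addCommGroupQ ProjMap.moduleP ProjMap.moduleQ
  ProjMap.finiteP ProjMap.finiteQ ProjMap.projectiveP ProjMap.projectiveQ

/-- `B ⊗_A σ` is an isomorphism for every `σ ∈ S`. -/
def InvertsAll (f : A →+* B) (S : Set (ProjMap A)) : Prop :=
  ∀ σ ∈ S, Function.Bijective (BaseChange.map f σ.hom)

/-- `f : A → B` is the universal localisation of `A` at the set `S` of maps between finitely
generated projective modules. -/
def IsUniversalLocalisation (S : Set (ProjMap A)) (f : A →+* B) : Prop :=
  InvertsAll f S ∧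
    ∀ (C : Type u) [Ring C] (g : A →+* C), InvertsAll g S → ∃! g' : B →+* C, g'.comp f = g

end Localisation

/-- A universal localisation `A → A_S` of `A`, at some set `S` of maps between finitely generated
projective `A`-modules. -/
structure UnivLoc (A : Type u) [Ring A] : Type (u + 1) where
  carrier : Type u
  [ring : Ring carrier]
  hom : A →+* carrier
  isLocalisation : ∃ S : Set (ProjMap A), IsUniversalLocalisation S hom

attribute [instance] UnivLoc.ring

/-- Equivalence of universal localisations as ring epimorphisms starting in `A`. -/
instance UnivLoc.setoid (A : Type u) [Ring A] : Setoid (UnivLoc A) where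
  r L M := ∃ e : L.carrier ≃+* M.carrier, e.toRingHom.comp L.hom = M.hom
  iseqv :=
    { refl := fun L => ⟨RingEquiv.refl _, by ext; simp⟩
      symm := by
        rintro L M ⟨e, he⟩
        refine ⟨e.symm, ?_⟩
        rw [← he]
        ext
        simp
      trans := by
        rintro L M N ⟨e, he⟩ ⟨e', he'⟩
        refine ⟨e.trans e', ?_⟩
        rw [← he', ← he]
        ext
        simp }

/-- The epiclasses of universal localisations of `A`. -/
def Uniloc (A : Type u) [Ring A] : Type (u + 1) := Quotient (UnivLoc.setoid A)

/-- The epiclass of a universal localisation. -/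
def UnivLoc.epiclass {A : Type u} [Ring A] (L : UnivLoc A) : Uniloc A :=
  Quotient.mk (UnivLoc.setoid A) L

/-! ### Path algebras -/

section PathAlgebra

set_option linter.unusedSectionVars false

variable (K : Type u) [Field K] (V : Type) [Quiver.{0} V] [Fintype V] [DecidableEq V]

/-- All paths of the quiver, with arbitrary source and target. -/
abbrev AnyPath : Type := Σ a b : V, Quiver.Path a b

/-- The path algebra `K V`: the vector space with the paths of the quiver as a basis. -/
def PathAlgebra : Type u := AnyPath V →₀ K

namespace PathAlgebra

noncomputable instance : AddCommGroup (PathAlgebra K V) :=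
  inferInstanceAs (AddCommGroup (AnyPath V →₀ K))

noncomputable instance : Module K (PathAlgebra K V) :=
  inferInstanceAs (Module K (AnyPath V →₀ K))

variable {V}

/-- The basis element given by a path. -/
noncomputable def ofPath {a b : V} (p : Quiver.Path a b) : PathAlgebra K V :=
  Finsupp.single (⟨a, b, p⟩ : AnyPath V) (1 : K)

/-- The product of two paths: `x * y` is the path "first `y`, then `x`" if `y` ends where `x`
starts, and zero otherwise. Left modules over the path algebra are thus representations of the
quiver. -/
noncomputable def mulPath (x y : AnyPath V) : PathAlgebra K V :=
  if h : x.1 = y.2.1 then ofPath K (y.2.2.comp (x.2.2.cast h rfl)) else 0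

variable (V)

/-- The bilinear extension of the product of paths. -/
noncomputable def mulLin :
    (AnyPath V →₀ K) →ₗ[K] (AnyPath V →₀ K) →ₗ[K] PathAlgebra K V :=
  Finsupp.linearCombination K fun x => Finsupp.linearCombination K fun y => mulPath K x y

noncomputable instance : Mul (PathAlgebra K V) := ⟨fun x y => mulLin K V x y⟩

noncomputable instance : One (PathAlgebra K V) :=
  ⟨∑ v : V, ofPath K (Quiver.Path.nil : Quiver.Path v v)⟩

variable {K V}

theorem mul_def (x y : PathAlgebra K V) : x * y = mulLin K V x y := rfl

theorem induction {motive : PathAlgebra K V → Prop} (x : PathAlgebra K V) (h0 : motive 0)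
    (hadd : ∀ x y, motive x → motive y → motive (x + y))
    (hsmul : ∀ (k : K) (a b : V) (p : Quiver.Path a b), motive (k • ofPath K p)) : motive x := by
  refine Finsupp.induction_linear (motive := motive) x h0 hadd ?_
  rintro ⟨a, b, p⟩ k
  have h : (Finsupp.single (⟨a, b, p⟩ : AnyPath V) k : AnyPath V →₀ K)
      = k • Finsupp.single (⟨a, b, p⟩ : AnyPath V) (1 : K) := by simp
  rw [h]
  exact hsmul k a b p

protected theorem add_mul (x y z : PathAlgebra K V) : (x + y) * z = x * z + y * z :=
  LinearMap.map_add₂ (mulLin K V) x y z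

protected theorem mul_add (x y z : PathAlgebra K V) : x * (y + z) = x * y + x * z :=
  map_add (mulLin K V x) y z

protected theorem zero_mul (x : PathAlgebra K V) : 0 * x = 0 :=
  LinearMap.map_zero₂ (mulLin K V) x

protected theorem mul_zero (x : PathAlgebra K V) : x * 0 = 0 :=
  map_zero (mulLin K V x)

protected theorem smul_mul (k : K) (x y : PathAlgebra K V) : (k • x) * y = k • (x * y) :=
  LinearMap.map_smul₂ (mulLin K V) k x y

protected theorem mul_smul (k : K) (x y : PathAlgebra K V) : x * (k • y) = k • (x * y) :=
  map_smul (mulLin K V x) k y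

theorem ofPath_mul_ofPath {a b c d : V} (p : Quiver.Path a b) (q : Quiver.Path c d) :
    ofPath K p * ofPath K q = mulPath K ⟨a, b, p⟩ ⟨c, d, q⟩ := by
  rw [mul_def, mulLin, ofPath, ofPath]
  erw [Finsupp.linearCombination_single, one_smul, Finsupp.linearCombination_single, one_smul]

theorem ofPath_mul_of_eq {a b c : V} (p : Quiver.Path b c) (q : Quiver.Path a b) :
    ofPath K p * ofPath K q = ofPath K (q.comp p) := by
  rw [ofPath_mul_ofPath, mulPath, dif_pos rfl]
  rfl

theorem ofPath_mul_of_ne {a b c d : V} (p : Quiver.Path a b) (q : Quiver.Path c d) (h : a ≠ d) :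
    ofPath K p * ofPath K q = 0 := by
  rw [ofPath_mul_ofPath, mulPath, dif_neg h]

protected theorem mul_assoc (x y z : PathAlgebra K V) : x * y * z = x * (y * z) := by
  induction x using PathAlgebra.induction with
  | h0 => simp only [PathAlgebra.zero_mul]
  | hadd x x' hx hx' => simp only [PathAlgebra.add_mul, hx, hx']
  | hsmul k a b p =>
  induction y using PathAlgebra.induction with
  | h0 => simp only [PathAlgebra.zero_mul, PathAlgebra.mul_zero]
  | hadd y y' hy hy' => simp only [PathAlgebra.add_mul, PathAlgebra.mul_add, hy, hy']
  | hsmul l c d q =>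
  induction z using PathAlgebra.induction with
  | h0 => simp only [PathAlgebra.mul_zero]
  | hadd z z' hz hz' => simp only [PathAlgebra.mul_add, hz, hz']
  | hsmul m e f r =>
  simp only [PathAlgebra.smul_mul, PathAlgebra.mul_smul]
  congr 3
  by_cases h : a = d
  · subst h
    by_cases h' : c = f
    · subst h'
      rw [ofPath_mul_of_eq, ofPath_mul_of_eq, ofPath_mul_of_eq, ofPath_mul_of_eq,
        Quiver.Path.comp_assoc]
    · rw [ofPath_mul_of_eq, ofPath_mul_of_ne _ _ h', ofPath_mul_of_ne _ _ h',
        PathAlgebra.mul_zero]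
  · rw [ofPath_mul_of_ne _ _ h, PathAlgebra.zero_mul]
    by_cases h' : c = f
    · subst h'
      rw [ofPath_mul_of_eq, ofPath_mul_of_ne _ _ h]
    · rw [ofPath_mul_of_ne _ _ h', PathAlgebra.mul_zero]

theorem one_def :
    (1 : PathAlgebra K V) = ∑ v : V, ofPath K (Quiver.Path.nil : Quiver.Path v v) := rfl

protected theorem sum_mul (s : V → PathAlgebra K V) (x : PathAlgebra K V) :
    (∑ v, s v) * x = ∑ v, s v * x := by
  simp only [mul_def]
  exact LinearMap.map_sum₂ (mulLin K V) Finset.univ s x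

protected theorem mul_sum (s : V → PathAlgebra K V) (x : PathAlgebra K V) :
    x * (∑ v, s v) = ∑ v, x * s v :=
  map_sum (mulLin K V x) s Finset.univ

protected theorem one_mul (x : PathAlgebra K V) : 1 * x = x := by
  induction x using PathAlgebra.induction with
  | h0 => exact PathAlgebra.mul_zero _
  | hadd x x' hx hx' => rw [PathAlgebra.mul_add, hx, hx']
  | hsmul k a b p =>
  rw [PathAlgebra.mul_smul, one_def, PathAlgebra.sum_mul, Finset.sum_eq_single b,
    ofPath_mul_of_eq, Quiver.Path.comp_nil]
  · intro v _ hv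
    exact ofPath_mul_of_ne _ _ hv
  · intro h
    exact absurd (Finset.mem_univ b) h

protected theorem mul_one (x : PathAlgebra K V) : x * 1 = x := by
  induction x using PathAlgebra.induction with
  | h0 => exact PathAlgebra.zero_mul _
  | hadd x x' hx hx' => rw [PathAlgebra.add_mul, hx, hx']
  | hsmul k a b p =>
  rw [PathAlgebra.smul_mul, one_def, PathAlgebra.mul_sum, Finset.sum_eq_single a,
    ofPath_mul_of_eq, Quiver.Path.nil_comp]
  · intro v _ hv
    exact ofPath_mul_of_ne _ _ (Ne.symm hv)
  · intro h
    exact absurd (Finset.mem_univ a) h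

noncomputable instance : Ring (PathAlgebra K V) :=
  { (inferInstance : AddCommGroup (PathAlgebra K V)) with
    mul := (· * ·)
    one := 1
    left_distrib := PathAlgebra.mul_add
    right_distrib := PathAlgebra.add_mul
    zero_mul := PathAlgebra.zero_mul
    mul_zero := PathAlgebra.mul_zero
    mul_assoc := PathAlgebra.mul_assoc
    one_mul := PathAlgebra.one_mul
    mul_one := PathAlgebra.mul_one }

end PathAlgebra

/-- The arrow ideal `R` of the path algebra: the two-sided ideal generated by the arrows. -/
noncomputable def arrowIdeal : Ideal (PathAlgebra K V) :=
  (TwoSidedIdeal.span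
    {x | ∃ (a b : V) (α : a ⟶ b), x = PathAlgebra.ofPath K α.toPath}).asIdeal

noncomputable instance : (arrowIdeal K V).IsTwoSided :=
  inferInstanceAs (TwoSidedIdeal.asIdeal _).IsTwoSided

/-- The truncated path algebra `K V / R ^ h`. -/
abbrev TruncatedPathAlgebra (h : ℕ) : Type u := PathAlgebra K V ⧸ (arrowIdeal K V) ^ h

variable {V} (h : ℕ)

/-- The residue class of a path in `K V / R ^ h`. -/
noncomputable def pathClass {a b : V} (p : Quiver.Path a b) : TruncatedPathAlgebra K V h :=
  Ideal.Quotient.mk _ (PathAlgebra.ofPath K p)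

/-- The indecomposable projective left module `P_v = A e_v` at the vertex `v`. -/
noncomputable def vertexProj (v : V) : Submodule (TruncatedPathAlgebra K V h)
    (TruncatedPathAlgebra K V h) :=
  Submodule.span _ {pathClass K h (Quiver.Path.nil : Quiver.Path v v)}

variable {K h} in
theorem pathClass_mem {j i : V} (p : Quiver.Path j i) : pathClass K h p ∈ vertexProj K h j := by
  refine Submodule.mem_span_singleton.2 ⟨pathClass K h p, ?_⟩
  rw [smul_eq_mul, pathClass, pathClass, ← map_mul, PathAlgebra.ofPath_mul_of_eq,
    Quiver.Path.nil_comp]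

/-- For a path `p` from `j` to `i`, the map `P_i → P_j`, `x ↦ x p`. -/
noncomputable def pathMap {j i : V} (p : Quiver.Path j i) :
    vertexProj K h i →ₗ[TruncatedPathAlgebra K V h] vertexProj K h j :=
  (LinearMap.toSpanSingleton (TruncatedPathAlgebra K V h) (TruncatedPathAlgebra K V h)
    (pathClass K h p)).restrict fun x _ => Submodule.smul_mem _ x (pathClass_mem p)

end PathAlgebra

/-! ### The arcs attached to a universal localisation -/

namespace UnivLoc

variable {K : Type u} [Field K] {V : Type} [Quiver.{0} V] [Fintype V] [DecidableEq V] {h : ℕ}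
  (L : UnivLoc (TruncatedPathAlgebra K V h))

/-- The localisation annihilates `P_k`. -/
def Kills (k : V) : Prop := Subsingleton (BaseChange L.hom (vertexProj K h k))

/-- There is a path from `j` to `i` whose map `P_i → P_j` is inverted by the localisation. -/
def Links (j i : V) : Prop :=
  ∃ p : Quiver.Path j i, Function.Bijective (BaseChange.map L.hom (pathMap K h p))

/-- The loops and arcs `(j, i)`, from `j` to `i`, attached to a universal localisation. There is an
arc from `j` to `i ≠ j` if `P_i → P_j` is a maximal composition of maps between indecomposable
projectives that do not vanish and become invertible; there is a loop at `k` if `P_k` is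
annihilated or if it is an intermediate term of such a composition. -/
def arcs : Set (V × V) :=
  {a | a.1 ≠ a.2 ∧ ¬ L.Kills a.1 ∧ L.Links a.1 a.2 ∧
      (∀ x, x ≠ a.1 → ¬ L.Links x a.1) ∧ ∀ y, y ≠ a.2 → ¬ L.Links a.2 y} ∪
  {a | a.1 = a.2 ∧ (L.Kills a.1 ∨
      ((∃ x, x ≠ a.1 ∧ L.Links x a.1) ∧ ∃ y, y ≠ a.1 ∧ L.Links a.1 y))}

end UnivLoc

/-! ### Two quivers with `n` vertices, numbered `0, …, n - 1` -/

/-- The vertices of the linear quiver `0 → 1 → ⋯ → n - 1`. -/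
def LineVertex (n : ℕ) : Type := Fin n

namespace LineVertex

variable {n : ℕ}

instance : Fintype (LineVertex n) := inferInstanceAs (Fintype (Fin n))

instance : DecidableEq (LineVertex n) := inferInstanceAs (DecidableEq (Fin n))

/-- The position of a vertex. -/
def pos (x : LineVertex n) : ℕ := Fin.val x

instance : Quiver.{0} (LineVertex n) := ⟨fun x y => PLift (x.pos + 1 = y.pos)⟩

end LineVertex

/-- The vertices of the cyclic quiver `0 → 1 → ⋯ → n - 1 → 0`. -/
def CircleVertex (n : ℕ) : Type := Fin n

namespace CircleVertex

variable {n : ℕ}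

instance : Fintype (CircleVertex n) := inferInstanceAs (Fintype (Fin n))

instance : DecidableEq (CircleVertex n) := inferInstanceAs (DecidableEq (Fin n))

/-- The position of a vertex. -/
def pos (x : CircleVertex n) : ℕ := Fin.val x

instance : Quiver.{0} (CircleVertex n) := ⟨fun x y => PLift ((x.pos + 1) % n = y.pos)⟩

/-- The number of steps from `x` to `y` in the direction of the arrows, between `0` and `n - 1`. -/
def dist (x y : CircleVertex n) : ℕ := (y.pos + n - x.pos) % n

end CircleVertex

/-- The algebra `K Δ_n / R ^ h` of the linear quiver. -/
abbrev LineAlgebra (K : Type u) [Field K] (n h : ℕ) : Type u :=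
  TruncatedPathAlgebra K (LineVertex n) h

/-- The algebra `K Δ̃_n / R ^ h` of the cyclic quiver. -/
abbrev CircleAlgebra (K : Type u) [Field K] (n h : ℕ) : Type u :=
  TruncatedPathAlgebra K (CircleVertex n) h

/-! ### Configurations of non-crossing arcs -/

/-- The points on the line that lie on the arc `a`, from `a.1` to `a.2`, end points included. -/
def LineVertex.support {n : ℕ} (a : LineVertex n × LineVertex n) : Set (LineVertex n) :=
  {x | a.1.pos ≤ x.pos ∧ x.pos ≤ a.2.pos}

/-- The points on the line that lie strictly between the end points of the arc `a`. -/
def LineVertex.inner {n : ℕ} (a : LineVertex n × LineVertex n) : Set (LineVertex n) :=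
  {x | a.1.pos < x.pos ∧ x.pos < a.2.pos}

/-- The points on the circle that one meets on the way from `a.1` to `a.2` in the direction of the
orientation, end points included. -/
def CircleVertex.support {n : ℕ} (a : CircleVertex n × CircleVertex n) : Set (CircleVertex n) :=
  {x | a.1.dist x ≤ a.1.dist a.2}

/-- The points on the circle that one meets strictly between `a.1` and `a.2`. -/
def CircleVertex.inner {n : ℕ} (a : CircleVertex n × CircleVertex n) : Set (CircleVertex n) :=
  {x | 0 < a.1.dist x ∧ a.1.dist x < a.1.dist a.2}

/-- Two arcs do not cross if they are completely separated or if one properly covers the other. -/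
def NonCrossing {V : Type} (support inner : V × V → Set V) (a b : V × V) : Prop :=
  Disjoint (support a) (support b) ∨ support a ⊆ inner b ∨ support b ⊆ inner a

/-- A configuration of non-crossing arcs of length at most `min (n - 1) (h - 1)` on a line with `n`
points. A pair `(j, j)` is a loop, of length zero. -/
@[ext]
structure LineConfig (n h : ℕ) where
  arcs : Set (LineVertex n × LineVertex n)
  ordered : ∀ a ∈ arcs, a.1.pos ≤ a.2.pos
  length_le : ∀ a ∈ arcs, a.2.pos - a.1.pos ≤ min (n - 1) (h - 1)
  nonCrossing : arcs.Pairwise (NonCrossing LineVertex.support LineVertex.inner)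

/-- A configuration of non-crossing arcs of length at most `min (n - 1) (h - 1)` on an oriented
circle with `n` points. A pair `(j, j)` is a loop, of length zero. -/
@[ext]
structure CircleConfig (n h : ℕ) where
  arcs : Set (CircleVertex n × CircleVertex n)
  length_le : ∀ a ∈ arcs, a.1.dist a.2 ≤ min (n - 1) (h - 1)
  nonCrossing : arcs.Pairwise (NonCrossing CircleVertex.support CircleVertex.inner)

/-! ### Extension of scalars and semilinear maps -/

/-! Both algebras are uniserial: in a line or an oriented cycle, two paths with a common source or a
common target are pieces of one another. A nonzero map between indecomposable projectives is
therefore multiplication by a path up to units (`exists_isUnitMulPath`), and every finitely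
generated projective is a sum of modules `P_v` (`exists_projCoords`). So a map between projectives
is a matrix of such elements. An entry with a shortest path divides its whole row and column, and
Gaussian elimination splits it off. The elimination takes place in the algebra itself, so it is
valid after every ring homomorphism. By induction, whether `B ⊗ σ` is invertible depends only on the
paths that `B` inverts and the vertices that it annihilates (`uniquelySolvable_transfer`,
`bijective_map_transfer`). A universal localisation is determined by these data.

Inverted paths satisfy two-out-of-three, and if two of them overlap, then all three pieces are
inverted (`Inverts.overlap`). At a vertex that is not annihilated they are shorter than `h`, because
longer paths vanish, and shorter than the number of vertices, because a closed path of positive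
length is nilpotent. The overlap rule makes distinct maximal links disjoint or properly nested.
Conversely the arcs recover the data: a loop stands for an annihilated vertex exactly when it lies
inside no maximal link (`killed_iff_of_linkArcs`), and two homomorphisms with the same arcs invert
the same paths (`inverts_of_linkArcs_eq`). This gives injectivity.

For surjectivity, each arc carries a representation that is one-dimensional on its vertices, with
the paths along the arc acting as identities. Given a configuration, one localises at the paths that
act invertibly on all representations of the test arcs. These representations extend to the
localisation, so nothing else is inverted or annihilated, and the non-crossing condition shows that
the arcs are the given ones (`exists_univLoc_linkArcs_eq`). The argument uses only the axioms of
`ChainQuiver`, shared by the line and the cycle. -/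

section BaseChangeHom

variable {A B : Type u} [Ring A] [Ring B] (f : A →+* B)

namespace BaseChange

variable {M N P : Type u} [AddCommGroup M] [Module A M] [AddCommGroup P] [Module A P]
  [AddCommGroup N] [Module B N]

/-- The canonical semilinear map `M → B ⊗_A M`. -/
def unit (M : Type u) [AddCommGroup M] [Module A M] : M →ₛₗ[f] BaseChange f M where
  toFun m := (balancedRel f M).mkQ (1 ⊗ₜ[ℤ] m)
  map_add' x y := by rw [TensorProduct.tmul_add, map_add]
  map_smul' a m := by
    rw [← map_smul, TensorProduct.smul_tmul', smul_eq_mul, mul_one, eq_comm, ← sub_eq_zero,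
      ← map_sub, Submodule.mkQ_apply, Submodule.Quotient.mk_eq_zero]
    exact Submodule.subset_span ⟨1, a, m, by rw [one_mul]⟩

variable {f}

theorem hom_ext {φ ψ : BaseChange f M →ₗ[B] N} (h : ∀ m, φ (unit f M m) = ψ (unit f M m)) :
    φ = ψ := by
  apply Submodule.linearMap_qext
  apply TensorProduct.AlgebraTensorModule.ext
  intro b m
  have := congrArg (b • ·) (h m)
  simp only [← map_smul] at this
  have e : b • unit f M m = (balancedRel f M).mkQ (b ⊗ₜ[ℤ] m) := by
    change b • (balancedRel f M).mkQ (1 ⊗ₜ[ℤ] m) = _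
    rw [← map_smul, TensorProduct.smul_tmul', smul_eq_mul, mul_one]
  rw [e] at this
  exact this

/-- The `B`-linear map `B ⊗_A M → N` that extends a semilinear map `M → N`. -/
def extend (φ : M →ₛₗ[f] N) : BaseChange f M →ₗ[B] N :=
  (balancedRel f M).liftQ
    (TensorProduct.AlgebraTensorModule.lift
      { toFun := fun b => b • φ.toAddMonoidHom.toIntLinearMap
        map_add' := fun b c => add_smul b c _
        map_smul' := fun b c => mul_smul b c _ }) (by
    rw [balancedRel, Submodule.span_le]
    rintro _ ⟨b, a, m, rfl⟩
    simp [mul_smul])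

@[simp]
theorem extend_unit (φ : M →ₛₗ[f] N) (m : M) : extend φ (unit f M m) = φ m := by
  change (1 : B) • φ m = φ m
  rw [one_smul]

@[simp]
theorem map_unit (σ : M →ₗ[A] P) (m : M) : map f σ (unit f M m) = unit f P (σ m) := rfl

/-- `B ⊗_A σ` is invertible if and only if every semilinear map extends uniquely along `σ`. -/
theorem bijective_map_iff (σ : M →ₗ[A] P) :
    Function.Bijective (map f σ) ↔ ∀ (N : Type u) [AddCommGroup N] [Module B N],
      Function.Bijective fun φ : P →ₛₗ[f] N => (φ.comp σ : M →ₛₗ[f] N) := by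
  constructor
  · intro hσ N _ _
    constructor
    · intro φ ψ h
      have : extend φ = extend ψ := by
        have h' : (extend φ).comp (map f σ) = (extend ψ).comp (map f σ) := by
          apply hom_ext
          intro m
          simpa using congrArg (fun χ => χ m) h
        exact (LinearMap.cancel_right hσ.2).1 h'
      ext x
      simpa using congrArg (fun χ => χ (unit f P x)) this
    · intro φ
      let e := LinearEquiv.ofBijective (map f σ) hσ
      refine ⟨((extend φ).comp e.symm.toLinearMap).comp (unit f P), ?_⟩
      ext m
      have : e.symm (unit f P (σ m)) = unit f M m := by
        rw [LinearEquiv.symm_apply_eq]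
        rfl
      simp [this]
  · intro h
    -- As in the Yoneda lemma, the extension of the unit of `M` along `σ` induces the inverse.
    obtain ⟨φ, hφ⟩ := (h (BaseChange f M)).2 (unit f M)
    have hφ' : ∀ m, φ (σ m) = unit f M m := fun m => congrArg (fun χ => χ m) hφ
    have h1 : (extend φ).comp (map f σ) = LinearMap.id := by
      apply hom_ext
      intro m
      simp [hφ']
    have h2 : (map f σ).comp (extend φ) = LinearMap.id := by
      have h3 : ((map f σ).comp (extend φ)).comp (unit f P) = unit f P := by
        apply (h (BaseChange f P)).1
        ext m
        simp [hφ']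
      apply hom_ext
      intro x
      exact congrArg (fun χ => χ x) h3
    exact ⟨Function.LeftInverse.injective fun x => congrArg (fun χ => χ x) h1,
      Function.RightInverse.surjective fun x => congrArg (fun χ => χ x) h2⟩

theorem subsingleton_iff : Subsingleton (BaseChange f M) ↔
    ∀ (N : Type u) [AddCommGroup N] [Module B N] (φ : M →ₛₗ[f] N), φ = 0 := by
  constructor
  · intro h N _ _ φ
    ext m
    rw [← extend_unit φ m, Subsingleton.elim (unit f M m) 0, map_zero, LinearMap.zero_apply]
  · intro h
    have : (LinearMap.id : BaseChange f M →ₗ[B] BaseChange f M) = 0 := by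
      apply hom_ext
      intro m
      simp [h _ (unit f M)]
    exact ⟨fun x y => (congrArg (fun χ => χ x) this).trans (congrArg (fun χ => χ y) this).symm⟩

end BaseChange

end BaseChangeHom

/-! ### Truncated path algebras -/

section Truncated

set_option linter.unusedSectionVars false

variable {K : Type u} [Field K] {V : Type} [Quiver.{0} V] [Fintype V] [DecidableEq V]

noncomputable instance PathAlgebra.instAlgebra : Algebra K (PathAlgebra K V) :=
  Algebra.ofModule PathAlgebra.smul_mul fun k x y => PathAlgebra.mul_smul k x y

namespace PathAlgebra

variable (K V) in
/-- The span of the paths of length at least `m`. -/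
noncomputable def longPaths (m : ℕ) : Submodule K (PathAlgebra K V) :=
  Submodule.span K {x | ∃ (a b : V) (p : Quiver.Path a b), m ≤ p.length ∧ x = ofPath K p}

theorem ofPath_mem_longPaths {a b : V} (p : Quiver.Path a b) {m : ℕ} (hm : m ≤ p.length) :
    ofPath K p ∈ longPaths K V m :=
  Submodule.subset_span ⟨a, b, p, hm, rfl⟩

theorem mem_longPaths_zero (x : PathAlgebra K V) : x ∈ longPaths K V 0 := by
  induction x using PathAlgebra.induction with
  | h0 => exact zero_mem _
  | hadd x y hx hy => exact add_mem hx hy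
  | hsmul k a b p => exact Submodule.smul_mem _ _ (ofPath_mem_longPaths p (Nat.zero_le _))

theorem mul_mem_longPaths {m l : ℕ} {x y : PathAlgebra K V} (hx : x ∈ longPaths K V m)
    (hy : y ∈ longPaths K V l) : x * y ∈ longPaths K V (m + l) := by
  have : longPaths K V m * longPaths K V l ≤ longPaths K V (m + l) := by
    rw [longPaths, longPaths, Submodule.span_mul_span, Submodule.span_le]
    rintro _ ⟨_, ⟨a, b, p, hp, rfl⟩, _, ⟨c, d, q, hq, rfl⟩, rfl⟩
    by_cases had : a = d
    · subst had
      simp only [ofPath_mul_of_eq]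
      exact ofPath_mem_longPaths _ (by rw [Quiver.Path.length_comp]; omega)
    · simp only [ofPath_mul_of_ne _ _ had]
      exact zero_mem _
  exact this (Submodule.mul_mem_mul hx hy)

/-- The span of the paths of positive length is already a two-sided ideal, and it contains the
arrows. -/
theorem arrowIdeal_le_longPaths {x : PathAlgebra K V} (hx : x ∈ arrowIdeal K V) :
    x ∈ longPaths K V 1 := by
  let I : TwoSidedIdeal (PathAlgebra K V) := TwoSidedIdeal.mk' (longPaths K V 1 : Set _)
    (zero_mem _) (fun hx hy => add_mem hx hy) (fun hx => neg_mem hx)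
    (fun {y x} hx => by simpa using mul_mem_longPaths (mem_longPaths_zero y) hx)
    (fun {x y} hx => by simpa using mul_mem_longPaths hx (mem_longPaths_zero y))
  have hI : ∀ y, y ∈ I ↔ y ∈ longPaths K V 1 := fun y => by
    rw [TwoSidedIdeal.mem_mk']
    rfl
  rw [← hI]
  rw [arrowIdeal, TwoSidedIdeal.mem_asIdeal, TwoSidedIdeal.mem_span_iff] at hx
  apply hx
  rintro _ ⟨a, b, α, rfl⟩
  rw [SetLike.mem_coe, hI]
  exact ofPath_mem_longPaths _ (le_of_eq (Quiver.Path.length_toPath α).symm)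

theorem arrowIdeal_pow_le_longPaths (m : ℕ) {x : PathAlgebra K V}
    (hx : x ∈ arrowIdeal K V ^ m) : x ∈ longPaths K V m := by
  induction m generalizing x with
  | zero => exact mem_longPaths_zero x
  | succ m ih =>
    rw [Submodule.pow_succ] at hx
    induction hx using Submodule.mul_induction_on' with
    | mem_mul_mem y hy z hz => exact mul_mem_longPaths (ih hy) (arrowIdeal_le_longPaths hz)
    | add y _ z _ hy hz => exact add_mem hy hz

theorem ofPath_mem_arrowIdeal_pow {a b : V} (p : Quiver.Path a b) :
    ofPath K p ∈ arrowIdeal K V ^ p.length := by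
  induction p with
  | nil => simp [Submodule.pow_zero, Ideal.one_eq_top]
  | cons p α ih =>
    have : ofPath K (p.cons α) = ofPath K α.toPath * ofPath K p := by
      rw [ofPath_mul_of_eq]
      rfl
    rw [this, Quiver.Path.length_cons, Ideal.IsTwoSided.pow_succ]
    refine Ideal.mul_mem_mul ?_ ih
    rw [arrowIdeal, TwoSidedIdeal.mem_asIdeal]
    exact TwoSidedIdeal.subset_span ⟨_, _, α, rfl⟩

end PathAlgebra

variable {h : ℕ}

local notation "𝔸" => TruncatedPathAlgebra K V h

variable (K h) in
/-- The idempotent of a vertex. -/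
noncomputable def vertexIdem (v : V) : 𝔸 := pathClass K h (Quiver.Path.nil : Quiver.Path v v)

theorem pathClass_mul_pathClass {a b c : V} (p : Quiver.Path b c) (q : Quiver.Path a b) :
    pathClass K h p * pathClass K h q = pathClass K h (q.comp p) := by
  rw [pathClass, pathClass, pathClass, ← map_mul, PathAlgebra.ofPath_mul_of_eq]

theorem pathClass_mul_of_ne {a b c d : V} (p : Quiver.Path a b) (q : Quiver.Path c d)
    (hne : a ≠ d) : pathClass K h p * pathClass K h q = 0 := by
  rw [pathClass, pathClass, ← map_mul, PathAlgebra.ofPath_mul_of_ne _ _ hne, map_zero]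

@[simp]
theorem pathClass_mul_vertexIdem {a b : V} (p : Quiver.Path a b) :
    pathClass K h p * vertexIdem K h a = pathClass K h p := by
  rw [vertexIdem, pathClass_mul_pathClass, Quiver.Path.nil_comp]

@[simp]
theorem vertexIdem_mul_pathClass {a b : V} (p : Quiver.Path a b) :
    vertexIdem K h b * pathClass K h p = pathClass K h p := by
  rw [vertexIdem, pathClass_mul_pathClass, Quiver.Path.comp_nil]

@[simp]
theorem vertexIdem_mul_self (a : V) :
    vertexIdem K h a * vertexIdem K h a = vertexIdem K h a := by
  rw [vertexIdem, pathClass_mul_pathClass, Quiver.Path.comp_nil]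

theorem sum_vertexIdem : ∑ v : V, vertexIdem K h v = 1 := by
  rw [← map_one (Ideal.Quotient.mk (arrowIdeal K V ^ h)), PathAlgebra.one_def, map_sum]
  rfl

theorem pathClass_eq_zero {a b : V} (p : Quiver.Path a b) (hp : h ≤ p.length) :
    pathClass K h p = 0 := by
  rw [pathClass, Ideal.Quotient.eq_zero_iff_mem]
  exact Ideal.pow_le_pow_right hp (PathAlgebra.ofPath_mem_arrowIdeal_pow p)

variable (K V h) in
/-- The span of the classes of the paths of length at least `m`. -/
noncomputable def longClasses (m : ℕ) : Submodule K 𝔸 :=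
  Submodule.span K {x | ∃ (a b : V) (p : Quiver.Path a b), m ≤ p.length ∧ x = pathClass K h p}

theorem pathClass_mem_longClasses {a b : V} (p : Quiver.Path a b) {m : ℕ} (hm : m ≤ p.length) :
    pathClass K h p ∈ longClasses K V h m :=
  Submodule.subset_span ⟨a, b, p, hm, rfl⟩

theorem mem_longClasses_zero (x : 𝔸) : x ∈ longClasses K V h 0 := by
  obtain ⟨x, rfl⟩ := Ideal.Quotient.mk_surjective x
  induction x using PathAlgebra.induction with
  | h0 => rw [map_zero]; exact zero_mem _
  | hadd x y hx hy => rw [map_add]; exact add_mem hx hy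
  | hsmul k a b p =>
    exact Submodule.smul_mem _ k (pathClass_mem_longClasses p (Nat.zero_le _))

theorem mul_mem_longClasses {m l : ℕ} {x y : 𝔸} (hx : x ∈ longClasses K V h m)
    (hy : y ∈ longClasses K V h l) : x * y ∈ longClasses K V h (m + l) := by
  have : longClasses K V h m * longClasses K V h l ≤ longClasses K V h (m + l) := by
    rw [longClasses, longClasses, Submodule.span_mul_span, Submodule.span_le]
    rintro _ ⟨_, ⟨a, b, p, hp, rfl⟩, _, ⟨c, d, q, hq, rfl⟩, rfl⟩
    by_cases had : a = d
    · subst had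
      simp only [pathClass_mul_pathClass]
      exact pathClass_mem_longClasses _ (by rw [Quiver.Path.length_comp]; omega)
    · simp only [pathClass_mul_of_ne _ _ had]
      exact zero_mem _
  exact this (Submodule.mul_mem_mul hx hy)

theorem mul_mem_longClasses_left {m : ℕ} (x : 𝔸) {y : 𝔸} (hy : y ∈ longClasses K V h m) :
    x * y ∈ longClasses K V h m := by
  simpa using mul_mem_longClasses (mem_longClasses_zero x) hy

theorem eq_zero_of_mem_longClasses {m : ℕ} (hm : h ≤ m) {x : 𝔸}
    (hx : x ∈ longClasses K V h m) : x = 0 := by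
  have : longClasses K V h m ≤ ⊥ := by
    rw [longClasses, Submodule.span_le]
    rintro _ ⟨a, b, p, hp, rfl⟩
    exact pathClass_eq_zero p (hm.trans hp)
  exact (Submodule.mem_bot K).1 (this hx)

theorem isNilpotent_of_mem_longClasses {x : 𝔸} (hx : x ∈ longClasses K V h 1) :
    IsNilpotent x := by
  have : ∀ m, x ^ m ∈ longClasses K V h m := by
    intro m
    induction m with
    | zero => exact mem_longClasses_zero _
    | succ m ih => rw [pow_succ]; exact mul_mem_longClasses ih hx
  exact ⟨h, eq_zero_of_mem_longClasses le_rfl (this h)⟩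

/-- A ring homomorphism from the truncated path algebra, given on paths. -/
noncomputable def liftPaths {C : Type u} [Ring C] [Algebra K C]
    (F : ∀ {a b : V}, Quiver.Path a b → C)
    (hmul : ∀ {a b c : V} (p : Quiver.Path b c) (q : Quiver.Path a b), F p * F q = F (q.comp p))
    (hne : ∀ {a b c d : V} (p : Quiver.Path a b) (q : Quiver.Path c d), a ≠ d → F p * F q = 0)
    (hone : ∑ v : V, F (Quiver.Path.nil : Quiver.Path v v) = 1)
    (hlong : ∀ {a b : V} (p : Quiver.Path a b), h ≤ p.length → F p = 0) : 𝔸 →+* C :=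
  let g : PathAlgebra K V →ₗ[K] C :=
    Finsupp.linearCombination K fun x : AnyPath V => F x.2.2
  have hg : ∀ {a b : V} (p : Quiver.Path a b), g (PathAlgebra.ofPath K p) = F p := by
    intro a b p
    change Finsupp.linearCombination K _ (Finsupp.single _ _) = _
    rw [Finsupp.linearCombination_single, one_smul]
  Ideal.Quotient.lift (arrowIdeal K V ^ h)
    { toFun := g
      map_one' := by
        rw [PathAlgebra.one_def, map_sum, ← hone]
        exact Finset.sum_congr rfl fun v _ => hg _
      map_mul' := by
        intro x y
        induction x using PathAlgebra.induction with
        | h0 => rw [zero_mul, map_zero, zero_mul]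
        | hadd x x' hx hx' => rw [add_mul, map_add, map_add, add_mul, hx, hx']
        | hsmul k a b p =>
        induction y using PathAlgebra.induction with
        | h0 => rw [mul_zero, map_zero, mul_zero]
        | hadd y y' hy hy' => rw [mul_add, map_add, map_add, mul_add, hy, hy']
        | hsmul l c d q =>
        rw [PathAlgebra.smul_mul, PathAlgebra.mul_smul, map_smul, map_smul, map_smul, map_smul,
          smul_mul_assoc, mul_smul_comm, hg, hg]
        congr 2
        by_cases had : a = d
        · subst had
          rw [PathAlgebra.ofPath_mul_of_eq, hg, hmul]
        · rw [PathAlgebra.ofPath_mul_of_ne _ _ had, map_zero, hne _ _ had]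
      map_zero' := map_zero g
      map_add' := map_add g }
    (by
      intro x hx
      have : PathAlgebra.longPaths K V h ≤ LinearMap.ker g := by
        rw [PathAlgebra.longPaths, Submodule.span_le]
        rintro _ ⟨a, b, p, hp, rfl⟩
        exact (hg p).trans (hlong p hp)
      exact this (PathAlgebra.arrowIdeal_pow_le_longPaths h hx))

theorem liftPaths_pathClass {C : Type u} [Ring C] [Algebra K C]
    (F : ∀ {a b : V}, Quiver.Path a b → C) (hmul hne hone hlong) {a b : V}
    (p : Quiver.Path a b) :
    liftPaths (K := K) (h := h) F hmul hne hone hlong (pathClass K h p) = F p := by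
  change Finsupp.linearCombination K _ (Finsupp.single _ _) = _
  rw [Finsupp.linearCombination_single, one_smul]

end Truncated

/-! ### Paths in quivers with at most one arrow into and out of each vertex -/

/-- A finite quiver in which every vertex has at most one incoming and at most one outgoing arrow,
and in which closed paths are as long as the number of vertices: a line or an oriented cycle. -/
class ChainQuiver (V : Type) [Quiver.{0} V] [Fintype V] : Prop where
  hom_subsingleton : ∀ a b : V, Subsingleton (a ⟶ b)
  out_unique : ∀ {a b c : V}, (a ⟶ b) → (a ⟶ c) → b = c
  in_unique : ∀ {a b c : V}, (b ⟶ a) → (c ⟶ a) → b = c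
  length_eq_zero : ∀ {a : V} (c : Quiver.Path a a), c.length < Fintype.card V → c.length = 0
  exists_cycle : ∀ {a b : V} (p : Quiver.Path a b), Fintype.card V ≤ p.length →
    ∃ (c : Quiver.Path a a) (q : Quiver.Path a b), 0 < c.length ∧ p = c.comp q

namespace Quiver.Path

variable {V : Type} [Quiver.{0} V] [Fintype V] [ChainQuiver V]

/-- With at most one arrow out of each vertex, both paths follow the same route until one of them
stops. -/
theorem eq_comp_or_eq_comp_of_source {a b c : V} (p : Path a b) (q : Path a c) :
    (∃ r : Path b c, q = p.comp r) ∨ ∃ r : Path c b, p = q.comp r := by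
  induction p with
  | nil => exact Or.inl ⟨q, (nil_comp q).symm⟩
  | @cons b b' p α ih =>
    rcases ih with ⟨r, rfl⟩ | ⟨r, rfl⟩
    · by_cases hr : r.length = 0
      · obtain rfl := eq_of_length_zero r hr
        rw [eq_nil_of_length_zero r hr]
        exact Or.inr ⟨α.toPath, rfl⟩
      · obtain ⟨d, β, r', hr', -⟩ := (length_ne_zero_iff_eq_comp r).1 hr
        obtain rfl := ChainQuiver.out_unique α β
        obtain rfl := (ChainQuiver.hom_subsingleton _ _).elim α β
        refine Or.inl ⟨r', ?_⟩
        rw [hr', ← comp_assoc]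
        rfl
    · exact Or.inr ⟨r.cons α, rfl⟩

theorem eq_comp_or_eq_comp_of_target {a b c : V} (p : Path b a) (q : Path c a) :
    (∃ r : Path c b, q = r.comp p) ∨ ∃ r : Path b c, p = r.comp q := by
  induction p with
  | nil => exact Or.inl ⟨q, (comp_nil q).symm⟩
  | @cons a' a p α ih =>
    cases q with
    | nil => exact Or.inr ⟨p.cons α, (comp_nil _).symm⟩
    | cons q β =>
      obtain rfl := ChainQuiver.in_unique α β
      obtain rfl := (ChainQuiver.hom_subsingleton _ _).elim α β
      rcases ih q with ⟨r, rfl⟩ | ⟨r, rfl⟩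
      · exact Or.inl ⟨r, rfl⟩
      · exact Or.inr ⟨r, rfl⟩

theorem exists_eq_comp_of_source {a b c : V} {p : Path a b} {q : Path a c}
    (h : p.length ≤ q.length) : ∃ r : Path b c, q = p.comp r := by
  rcases eq_comp_or_eq_comp_of_source p q with h' | ⟨r, rfl⟩
  · exact h'
  · have hr : r.length = 0 := by rw [length_comp] at h; omega
    obtain rfl := eq_of_length_zero r hr
    rw [eq_nil_of_length_zero r hr]
    exact ⟨nil, rfl⟩

theorem exists_eq_comp_of_target {a b c : V} {p : Path b a} {q : Path c a}
    (h : p.length ≤ q.length) : ∃ r : Path c b, q = r.comp p := by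
  rcases eq_comp_or_eq_comp_of_target p q with h' | ⟨r, rfl⟩
  · exact h'
  · have hr : r.length = 0 := by rw [length_comp] at h; omega
    obtain rfl := eq_of_length_zero r hr
    rw [eq_nil_of_length_zero r hr]
    exact ⟨nil, by simp⟩

/-- One path extends the other by a closed path, which is too short to be nontrivial. -/
theorem eq_of_length_lt_card {a b : V} {p q : Path a b} (hp : p.length < Fintype.card V)
    (hq : q.length < Fintype.card V) : p = q := by
  rcases eq_comp_or_eq_comp_of_source p q with ⟨r, rfl⟩ | ⟨r, rfl⟩ <;>
  · rw [length_comp] at *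
    have := ChainQuiver.length_eq_zero r (by omega)
    rw [eq_nil_of_length_zero r this, comp_nil]

end Quiver.Path

/-! ### Homomorphisms between indecomposable projective modules -/

section Uniserial

set_option linter.unusedSectionVars false

variable {K : Type u} [Field K] {V : Type} [Quiver.{0} V] [Fintype V] [DecidableEq V] {h : ℕ}

local notation "𝔸" => TruncatedPathAlgebra K V h

/-- Multiplication by the two idempotents fixes the paths from `j` to `i` and annihilates all
others. -/
theorem mem_span_pathClass {i j : V} {x : 𝔸} (hx : vertexIdem K h i * x * vertexIdem K h j = x) :
    x ∈ Submodule.span K (Set.range fun p : Quiver.Path j i => pathClass K h p) := by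
  have key : longClasses K V h 0 ≤ (Submodule.span K (Set.range fun p : Quiver.Path j i =>
      pathClass K h p)).comap ((LinearMap.mulLeft K (vertexIdem K h i)).comp
        (LinearMap.mulRight K (vertexIdem K h j))) := by
    rw [longClasses, Submodule.span_le]
    rintro _ ⟨a, b, p, -, rfl⟩
    simp only [Submodule.comap_coe, Set.mem_preimage, LinearMap.comp_apply,
      LinearMap.mulLeft_apply, LinearMap.mulRight_apply, SetLike.mem_coe]
    by_cases ha : a = j
    · subst ha
      rw [pathClass_mul_vertexIdem]
      by_cases hb : i = b
      · subst hb
        rw [vertexIdem_mul_pathClass]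
        exact Submodule.subset_span ⟨p, rfl⟩
      · rw [vertexIdem, pathClass_mul_of_ne _ _ hb]
        exact zero_mem _
    · rw [vertexIdem.eq_def K h j, pathClass_mul_of_ne _ _ ha, mul_zero]
      exact zero_mem _
  have := key (mem_longClasses_zero x)
  rwa [Submodule.mem_comap, LinearMap.comp_apply, LinearMap.mulRight_apply,
    LinearMap.mulLeft_apply, ← mul_assoc, hx] at this

theorem isUnit_smul_one_add {k : K} (hk : k ≠ 0) {y : 𝔸} (hy : y ∈ longClasses K V h 1) :
    IsUnit (k • (1 : 𝔸) + y) := by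
  refine (isNilpotent_of_mem_longClasses hy).isUnit_add_left_of_commute ?_ ?_
  · rw [← Algebra.algebraMap_eq_smul_one]
    exact (IsUnit.mk0 k hk).map _
  · rw [← Algebra.algebraMap_eq_smul_one]
    exact Algebra.commute_algebraMap_right k y

/-- `x` is, up to units, the class of the path `p`. -/
structure IsUnitMulPath {i j : V} (x : 𝔸) (p : Quiver.Path j i) : Prop where
  right : ∃ U : 𝔸ˣ, x = pathClass K h p * U ∧ Commute (U : 𝔸) (vertexIdem K h j)
  left : ∃ U : 𝔸ˣ, x = U * pathClass K h p

/-- Among the paths that occur in `x`, a shortest one `p` is an initial and a final piece of all the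
others. Factoring it out on either side leaves a nonzero scalar plus a combination of paths of
positive length, which is a unit because the latter is nilpotent. -/
theorem exists_isUnitMulPath [ChainQuiver V] {i j : V} {x : 𝔸}
    (hx : vertexIdem K h i * x * vertexIdem K h j = x) (hx0 : x ≠ 0) :
    ∃ p : Quiver.Path j i, IsUnitMulPath x p := by
  classical
  obtain ⟨c, hc⟩ := Finsupp.mem_span_range_iff_exists_finsupp.1 (mem_span_pathClass hx)
  rw [Finsupp.sum] at hc
  have hne : c.support.Nonempty := by
    rw [Finset.nonempty_iff_ne_empty]
    intro h0
    rw [h0, Finset.sum_empty] at hc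
    exact hx0 hc.symm
  obtain ⟨p, hp, hmin⟩ := Finset.exists_min_image c.support (fun q => q.length) hne
  have hpc : c p ≠ 0 := Finsupp.mem_support_iff.1 hp
  refine ⟨p, ?_, ?_⟩
  · have hr : ∀ q ∈ c.support.erase p, ∃ r : Quiver.Path j j, q = r.comp p ∧ 1 ≤ r.length := by
      intro q hq
      obtain ⟨hqp, hq⟩ := Finset.mem_erase.1 hq
      obtain ⟨r, hr⟩ := Quiver.Path.exists_eq_comp_of_target (hmin q hq)
      refine ⟨r, hr, Nat.one_le_iff_ne_zero.2 fun h0 => hqp ?_⟩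
      rw [hr, Quiver.Path.eq_nil_of_length_zero r h0, Quiver.Path.nil_comp]
    choose! r hr using hr
    have hu := isUnit_smul_one_add hpc (y := ∑ q ∈ c.support.erase p, c q • pathClass K h (r q))
      (Submodule.sum_mem _ fun q hq => Submodule.smul_mem _ _
        (pathClass_mem_longClasses _ (hr q hq).2))
    refine ⟨hu.unit, ?_, ?_⟩
    · rw [← hc, ← Finset.add_sum_erase _ _ hp, IsUnit.unit_spec, mul_add, mul_smul_comm, mul_one,
        Finset.mul_sum]
      congr 1
      refine Finset.sum_congr rfl fun q hq => ?_
      rw [mul_smul_comm, pathClass_mul_pathClass, ← (hr q hq).1]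
    · rw [IsUnit.unit_spec]
      refine Commute.add_left ((Commute.one_left _).smul_left _)
        (Commute.sum_left _ _ _ fun q _ => Commute.smul_left ?_ _)
      rw [Commute, SemiconjBy, pathClass_mul_vertexIdem, vertexIdem_mul_pathClass]
  · have hr : ∀ q ∈ c.support.erase p, ∃ r : Quiver.Path i i, q = p.comp r ∧ 1 ≤ r.length := by
      intro q hq
      obtain ⟨hqp, hq⟩ := Finset.mem_erase.1 hq
      obtain ⟨r, hr⟩ := Quiver.Path.exists_eq_comp_of_source (hmin q hq)
      refine ⟨r, hr, Nat.one_le_iff_ne_zero.2 fun h0 => hqp ?_⟩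
      rw [hr, Quiver.Path.eq_nil_of_length_zero r h0, Quiver.Path.comp_nil]
    choose! r hr using hr
    have hu := isUnit_smul_one_add hpc (y := ∑ q ∈ c.support.erase p, c q • pathClass K h (r q))
      (Submodule.sum_mem _ fun q hq => Submodule.smul_mem _ _
        (pathClass_mem_longClasses _ (hr q hq).2))
    refine ⟨hu.unit, ?_⟩
    rw [← hc, ← Finset.add_sum_erase _ _ hp, IsUnit.unit_spec, add_mul, smul_mul_assoc, one_mul,
      Finset.sum_mul]
    congr 1
    refine Finset.sum_congr rfl fun q hq => ?_
    rw [smul_mul_assoc, pathClass_mul_pathClass, ← (hr q hq).1]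

/-- The shorter of two paths with a common target is a final piece of the longer one. Together with
its mirror image, this lets a shortest entry serve as a pivot for its row and column. -/
theorem IsUnitMulPath.exists_eq_mul [ChainQuiver V] {i j j' : V} {x y : 𝔸} {p : Quiver.Path j i}
    {q : Quiver.Path j' i} (hx : IsUnitMulPath x p) (hy : IsUnitMulPath y q)
    (hpq : p.length ≤ q.length) : ∃ c, y = x * c := by
  obtain ⟨r, rfl⟩ := Quiver.Path.exists_eq_comp_of_target hpq
  obtain ⟨U, rfl, -⟩ := hx.right
  obtain ⟨W, rfl, -⟩ := hy.right
  refine ⟨↑U⁻¹ * pathClass K h r * W, ?_⟩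
  rw [← pathClass_mul_pathClass]
  simp only [mul_assoc, Units.mul_inv_cancel_left]

theorem IsUnitMulPath.exists_mul_eq [ChainQuiver V] {i i' j : V} {x y : 𝔸} {p : Quiver.Path j i}
    {q : Quiver.Path j i'} (hx : IsUnitMulPath x p) (hy : IsUnitMulPath y q)
    (hpq : p.length ≤ q.length) : ∃ d, y = d * x := by
  obtain ⟨r, rfl⟩ := Quiver.Path.exists_eq_comp_of_source hpq
  obtain ⟨U, rfl⟩ := hx.left
  obtain ⟨W, rfl⟩ := hy.left
  refine ⟨W * pathClass K h r * ↑U⁻¹, ?_⟩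
  rw [← pathClass_mul_pathClass]
  simp only [mul_assoc, Units.inv_mul_cancel_left]

end Uniserial

/-! ### Linear systems over a ring -/

section Systems

variable {B : Type u} [Ring B]

/-- For every `y` fixed by `e` there is a unique `x` fixed by `e'` with `a x = y`. -/
def ActsBijectively (N : Type u) [AddCommGroup N] [Module B N] (e e' a : B) : Prop :=
  ∀ y : N, e • y = y → ∃! x : N, e' • x = x ∧ a • x = y

/-- The linear system `∑ t, M s t • x t = y s`, with unknowns `x t` fixed by `e' t` and right-hand
sides `y s` fixed by `e s`, is uniquely solvable. -/
def UniquelySolvable (N : Type u) [AddCommGroup N] [Module B N] {m l : ℕ} (e : Fin m → B)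
    (e' : Fin l → B) (M : Fin m → Fin l → B) : Prop :=
  ∀ y : Fin m → N, (∀ s, e s • y s = y s) →
    ∃! x : Fin l → N, (∀ t, e' t • x t = x t) ∧ ∀ s, ∑ t, M s t • x t = y s

/-- A Yoneda argument: the module `B` itself detects invertibility. Solving for the right-hand side
`e` yields a right inverse `b`. -/
theorem exists_inverse_iff_actsBijectively {e e' a : B} (hee : e * e = e) (hee' : e' * e' = e')
    (hea : e * a = a) (hae : a * e' = a) :
    (∃ b, a * b = e ∧ b * a = e') ↔
      ∀ (N : Type u) [AddCommGroup N] [Module B N], ActsBijectively N e e' a := by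
  constructor
  · rintro ⟨b, hab, hba⟩ N _ _ y hy
    refine ⟨e' • b • y, ⟨by rw [← mul_smul, hee'], ?_⟩, ?_⟩
    · rw [← mul_smul, ← mul_smul, hae, hab, hy]
    · rintro x ⟨hx, hxy⟩
      rw [← hxy, ← mul_smul b, hba, hx, hx]
  · intro H
    obtain ⟨b, ⟨hb, hab⟩, -⟩ := H B e hee
    simp only [smul_eq_mul] at hb hab
    refine ⟨b, hab, ?_⟩
    -- Both `b * a` and `e'` solve the equation with right-hand side `a`, so uniqueness identifies
    -- them.
    obtain ⟨c, -, hc⟩ := H B a hea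
    rw [hc (b * a) ⟨by rw [smul_eq_mul, ← mul_assoc, hb], by rw [smul_eq_mul, ← mul_assoc, hab, hea]⟩,
      hc e' ⟨hee', hae⟩]

/-- Elimination of one unknown and one equation from a linear system. -/
theorem uniquelySolvable_iff_eliminate {N : Type u} [AddCommGroup N] [Module B N] {m l : ℕ}
    {e : Fin (m + 1) → B} {e' : Fin (l + 1) → B} {M : Fin (m + 1) → Fin (l + 1) → B}
    (s₀ : Fin (m + 1)) (t₀ : Fin (l + 1)) (c : Fin l → B) (d : Fin m → B)
    (hc : ∀ t, M s₀ (t₀.succAbove t) = M s₀ t₀ * c t) (hc' : ∀ t, e' t₀ * c t = c t)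
    (hd : ∀ s, M (s₀.succAbove s) t₀ = d s * M s₀ t₀)
    (hd' : ∀ s, e (s₀.succAbove s) * d s = d s) :
    UniquelySolvable N e e' M ↔ ActsBijectively N (e s₀) (e' t₀) (M s₀ t₀) ∧
      UniquelySolvable N (fun s => e (s₀.succAbove s)) (fun t => e' (t₀.succAbove t))
        (fun s t => M (s₀.succAbove s) (t₀.succAbove t) - d s * M s₀ t₀ * c t) := by
  -- The pivot divides its row, so equation `s₀` involves only the new unknown `x t₀ + ∑ t, c t • x
  -- t`.
  have hfirst : ∀ x : Fin (l + 1) → N, ∑ t, M s₀ t • x t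
      = M s₀ t₀ • (x t₀ + ∑ t, c t • x (t₀.succAbove t)) := by
    intro x
    rw [Fin.sum_univ_succAbove _ t₀, smul_add, Finset.smul_sum]
    congr 1
    exact Finset.sum_congr rfl fun t _ => by rw [hc, mul_smul]
  -- The pivot divides its column, so subtracting `d s` times equation `s₀` removes the unknown
  -- `t₀`.
  have hrest : ∀ (x : Fin (l + 1) → N) (s : Fin m), ∑ t, M (s₀.succAbove s) t • x t
      = d s • (∑ t, M s₀ t • x t) + ∑ t, (M (s₀.succAbove s) (t₀.succAbove t)
        - d s * M s₀ t₀ * c t) • x (t₀.succAbove t) := by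
    intro x s
    rw [hfirst, Fin.sum_univ_succAbove _ t₀, hd, smul_add, smul_add, ← mul_smul, add_assoc]
    congr 1
    rw [Finset.smul_sum, Finset.smul_sum, ← Finset.sum_add_distrib]
    refine Finset.sum_congr rfl fun t _ => ?_
    rw [sub_smul, mul_smul, mul_smul]
    abel
  have hfix : ∀ x : Fin (l + 1) → N, e' t₀ • (∑ t, c t • x (t₀.succAbove t))
      = ∑ t, c t • x (t₀.succAbove t) := by
    intro x
    rw [Finset.smul_sum]
    exact Finset.sum_congr rfl fun t _ => by rw [← mul_smul, hc']
  constructor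
  · intro H
    constructor
    · intro y hy
      -- With the right-hand sides `d s • y` the reduced system becomes homogeneous, so every
      -- solution of the pivot equation extends by zeros.
      have hY : ∀ s, e s • (s₀.insertNth y (fun s => d s • y) : Fin (m + 1) → N) s
          = (s₀.insertNth y (fun s => d s • y) : Fin (m + 1) → N) s := by
        rw [Fin.forall_iff_succAbove s₀]
        simp only [Fin.insertNth_apply_same, Fin.insertNth_apply_succAbove]
        exact ⟨hy, fun s => by rw [← mul_smul, hd']⟩
      obtain ⟨x, ⟨hx, hxy⟩, huniq⟩ := H _ hY
      have hx0 := hxy s₀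
      rw [hfirst, Fin.insertNth_apply_same] at hx0
      refine ⟨_, ⟨?_, hx0⟩, ?_⟩
      · rw [smul_add, hfix, hx]
      · have main : ∀ z, e' t₀ • z = z ∧ M s₀ t₀ • z = y →
            (t₀.insertNth z (fun _ => 0) : Fin (l + 1) → N) = x := by
          rintro z ⟨hz, hzy⟩
          apply huniq
          constructor
          · rw [Fin.forall_iff_succAbove t₀]
            simp only [Fin.insertNth_apply_same, Fin.insertNth_apply_succAbove]
            exact ⟨hz, fun t => smul_zero _⟩
          · rw [Fin.forall_iff_succAbove s₀]
            simp only [hrest, hfirst]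
            simp [hzy]
        intro z hz
        have h1 := congrFun (main z hz) t₀
        have h2 := congrFun (main _ ⟨by rw [smul_add, hfix, hx], hx0⟩) t₀
        rw [Fin.insertNth_apply_same] at h1 h2
        exact h1.trans h2.symm
    · intro y hy
      have hY : ∀ s, e s • (s₀.insertNth 0 y : Fin (m + 1) → N) s
          = (s₀.insertNth 0 y : Fin (m + 1) → N) s := by
        rw [Fin.forall_iff_succAbove s₀]
        simp only [Fin.insertNth_apply_same, Fin.insertNth_apply_succAbove]
        exact ⟨smul_zero _, hy⟩
      obtain ⟨x, ⟨hx, hxy⟩, huniq⟩ := H _ hY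
      refine ⟨fun t => x (t₀.succAbove t), ⟨fun t => hx _, fun s => ?_⟩, ?_⟩
      · have := hxy (s₀.succAbove s)
        rw [hrest, hxy s₀, Fin.insertNth_apply_same, smul_zero, zero_add,
          Fin.insertNth_apply_succAbove] at this
        exact this
      · rintro z ⟨hz, hzy⟩
        -- This value at `t₀` makes the new unknown vanish, so that equation `s₀` holds with
        -- right-hand side zero.
        have : (t₀.insertNth (-∑ t, c t • z t) z : Fin (l + 1) → N) = x := by
          have hf := hfix (t₀.insertNth (-∑ t, c t • z t) z)
          simp only [Fin.insertNth_apply_succAbove] at hf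
          apply huniq
          constructor
          · rw [Fin.forall_iff_succAbove t₀]
            simp only [Fin.insertNth_apply_same, Fin.insertNth_apply_succAbove]
            exact ⟨by rw [smul_neg, hf], hz⟩
          · rw [Fin.forall_iff_succAbove s₀]
            simp only [hrest, hfirst]
            simp [hzy]
        funext t
        rw [← this, Fin.insertNth_apply_succAbove]
  · rintro ⟨H₁, H₂⟩ y hy
    obtain ⟨z, ⟨hz, hzy⟩, huz⟩ := H₂ (fun s => y (s₀.succAbove s) - d s • y s₀) (fun s => by
      rw [smul_sub, hy, ← mul_smul, hd'])
    obtain ⟨w, ⟨hw, hwy⟩, huw⟩ := H₁ (y s₀) (hy s₀)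
    have hf := hfix (t₀.insertNth (w - ∑ t, c t • z t) z)
    simp only [Fin.insertNth_apply_succAbove] at hf
    refine ⟨t₀.insertNth (w - ∑ t, c t • z t) z, ⟨?_, ?_⟩, ?_⟩
    · rw [Fin.forall_iff_succAbove t₀]
      simp only [Fin.insertNth_apply_same, Fin.insertNth_apply_succAbove]
      exact ⟨by rw [smul_sub, hf, hw], hz⟩
    · rw [Fin.forall_iff_succAbove s₀]
      simp only [hrest, hfirst]
      simp [hzy, hwy]
    · rintro x ⟨hx, hxy⟩
      have h0 := hxy s₀
      have hxw : x t₀ + ∑ t, c t • x (t₀.succAbove t) = w := by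
        rw [hfirst] at h0
        exact huw _ ⟨by rw [smul_add, hfix, hx], h0⟩
      have hxz : (fun t => x (t₀.succAbove t)) = z := by
        refine huz _ ⟨fun t => hx _, fun s => ?_⟩
        have := hxy (s₀.succAbove s)
        rw [hrest, h0] at this
        exact eq_sub_of_add_eq' this
      rw [Fin.eq_insertNth_iff]
      refine ⟨?_, hxz⟩
      rw [← hxw, ← hxz, add_sub_cancel_right]

end Systems

/-! ### Finitely generated projective modules over truncated path algebras -/

section Coordinates

set_option linter.unusedSectionVars false

variable {K : Type u} [Field K] {V : Type} [Quiver.{0} V] [Fintype V] [DecidableEq V] {h : ℕ}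

local notation "𝔸" => TruncatedPathAlgebra K V h

/-- An isomorphism of `P` with the direct sum of the modules `P_{v s}`, given by generators and
coordinate functions. -/
structure ProjCoords (K : Type u) [Field K] {V : Type} [Quiver.{0} V] [Fintype V] [DecidableEq V]
    (h : ℕ) (P : Type u) [AddCommGroup P] [Module (TruncatedPathAlgebra K V h) P] {m : ℕ}
    (v : Fin m → V) where
  gen : Fin m → P
  coord : Fin m → P →ₗ[TruncatedPathAlgebra K V h] TruncatedPathAlgebra K V h
  sum_coord : ∀ p, ∑ s, coord s p • gen s = p
  coord_gen : ∀ s t, coord s (gen t) = if t = s then vertexIdem K h (v s) else 0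

namespace ProjCoords

variable {P : Type u} [AddCommGroup P] [Module (TruncatedPathAlgebra K V h) P] {m : ℕ} {v : Fin m → V}
  (c : ProjCoords K h P v)

theorem vertexIdem_smul_gen (t : Fin m) : vertexIdem K h (v t) • c.gen t = c.gen t := by
  conv_rhs => rw [← c.sum_coord (c.gen t)]
  simp [c.coord_gen]

theorem coord_mul_vertexIdem (s : Fin m) (p : P) :
    c.coord s p * vertexIdem K h (v s) = c.coord s p := by
  conv_rhs => rw [← c.sum_coord p]
  simp [c.coord_gen]

variable {B : Type u} [Ring B] (f : TruncatedPathAlgebra K V h →+* B) {N : Type u} [AddCommGroup N]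
  [Module B N]

/-- The semilinear map with given values at the generators. -/
noncomputable def extend (y : Fin m → N) : P →ₛₗ[f] N where
  toFun p := ∑ s, f (c.coord s p) • y s
  map_add' p q := by simp [add_smul, Finset.sum_add_distrib]
  map_smul' a p := by simp [mul_smul, Finset.smul_sum]

theorem extend_gen (y : Fin m → N) (hy : ∀ s, f (vertexIdem K h (v s)) • y s = y s) (t : Fin m) :
    c.extend f y (c.gen t) = y t := by
  change ∑ s, f (c.coord s (c.gen t)) • y s = y t
  rw [Finset.sum_eq_single t]
  · rw [c.coord_gen, if_pos rfl, hy]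
  · intro s _ hs
    rw [c.coord_gen, if_neg (Ne.symm hs), map_zero, zero_smul]
  · intro ht
    exact absurd (Finset.mem_univ t) ht

variable {f} in
theorem map_gen_fixed (φ : P →ₛₗ[f] N) (t : Fin m) :
    f (vertexIdem K h (v t)) • φ (c.gen t) = φ (c.gen t) := by
  rw [← LinearMap.map_smulₛₗ, c.vertexIdem_smul_gen]

variable {f} in
theorem map_eq_sum (φ : P →ₛₗ[f] N) (p : P) : φ p = ∑ s, f (c.coord s p) • φ (c.gen s) := by
  conv_lhs => rw [← c.sum_coord p]
  simp

variable {f} in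
theorem hom_ext {φ ψ : P →ₛₗ[f] N} (H : ∀ t, φ (c.gen t) = ψ (c.gen t)) : φ = ψ := by
  ext p
  rw [c.map_eq_sum φ, c.map_eq_sum ψ]
  simp only [H]

variable {Q : Type u} [AddCommGroup Q] [Module (TruncatedPathAlgebra K V h) Q] {l : ℕ}
  {w : Fin l → V} (d : ProjCoords K h Q w)

/-- A semilinear map out of a sum of modules `P_v` amounts to its values at the generators, which
only have to be fixed by the idempotents. Composition with `σ` then becomes the linear system given
by the matrix of `σ`. -/
theorem bijective_comp_iff (σ : P →ₗ[𝔸] Q) :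
    (Function.Bijective fun φ : Q →ₛₗ[f] N => (φ.comp σ : P →ₛₗ[f] N)) ↔
      UniquelySolvable N (fun s => f (vertexIdem K h (v s))) (fun t => f (vertexIdem K h (w t)))
        (fun s t => f (d.coord t (σ (c.gen s)))) := by
  constructor
  · rintro H y hy
    obtain ⟨φ, hφ⟩ := H.2 (c.extend f y)
    refine ⟨fun t => φ (d.gen t), ⟨fun t => d.map_gen_fixed φ t, fun s => ?_⟩, ?_⟩
    · rw [← d.map_eq_sum φ, ← c.extend_gen f y hy s, ← hφ]
      rfl
    · rintro x ⟨hx, hxy⟩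
      have : d.extend f x = φ := by
        apply H.1
        rw [hφ]
        apply c.hom_ext
        intro s
        rw [c.extend_gen f y hy s, ← hxy s]
        rfl
      funext t
      rw [← this, d.extend_gen f x hx]
  · intro H
    constructor
    · intro φ ψ hφψ
      obtain ⟨x, -, hx⟩ := H (fun s => φ (σ (c.gen s)))
        (fun s => c.map_gen_fixed (φ.comp σ : P →ₛₗ[f] N) s)
      have h1 := hx (fun t => φ (d.gen t)) ⟨fun t => d.map_gen_fixed φ t, fun s =>
        (d.map_eq_sum φ _).symm⟩
      have h2 := hx (fun t => ψ (d.gen t)) ⟨fun t => d.map_gen_fixed ψ t, fun s =>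
        (d.map_eq_sum ψ _).symm.trans (congrArg (fun χ => χ (c.gen s)) hφψ).symm⟩
      exact d.hom_ext fun t => congrFun (h1.trans h2.symm) t
    · intro φ
      obtain ⟨x, ⟨hx, hxy⟩, -⟩ := H (fun s => φ (c.gen s)) (fun s => c.map_gen_fixed φ s)
      refine ⟨d.extend f x, c.hom_ext fun s => ?_⟩
      rw [← hxy s]
      rfl

end ProjCoords

/-- As in Nakayama's lemma: a component of `a s` outside the radical is a unit times the idempotent
of `v s`, and solving the relation for `x s` would make that generator redundant. -/
theorem mem_longClasses_of_minimal [ChainQuiver V] {P : Type u} [AddCommGroup P] [Module 𝔸 P]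
    {m : ℕ} {v : Fin m → V} {x : Fin m → P} (hx : ∀ s, vertexIdem K h (v s) • x s = x s)
    (hspan : ∀ s, x s ∉ Submodule.span 𝔸 (x '' {t | t ≠ s})) {a : Fin m → 𝔸}
    (ha : ∑ s, a s • x s = 0) (hav : ∀ s, a s * vertexIdem K h (v s) = a s) (s : Fin m) :
    a s ∈ longClasses K V h 1 := by
  have hsum : a s = ∑ i, vertexIdem K h i * a s := by
    rw [← Finset.sum_mul, sum_vertexIdem, one_mul]
  rw [hsum]
  refine Submodule.sum_mem _ fun i _ => ?_
  by_contra hi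
  have hy : vertexIdem K h i * (vertexIdem K h i * a s) * vertexIdem K h (v s)
      = vertexIdem K h i * a s := by
    rw [← mul_assoc, vertexIdem_mul_self, mul_assoc, hav]
  obtain ⟨p, hp⟩ := exists_isUnitMulPath hy (fun h0 => hi (h0 ▸ zero_mem _))
  obtain ⟨U, hU⟩ := hp.left
  by_cases hp0 : p.length = 0
  · have hiv := Quiver.Path.eq_of_length_zero p hp0
    subst hiv
    rw [Quiver.Path.eq_nil_of_length_zero p hp0] at hU
    apply hspan s
    have h1 : ∑ t, (vertexIdem K h (v s) * a t) • x t = 0 := by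
      simp only [mul_smul, ← Finset.smul_sum, ha, smul_zero]
    rw [← Finset.add_sum_erase _ _ (Finset.mem_univ s), hU] at h1
    have h2 : x s = (↑U⁻¹ : 𝔸) • -∑ t ∈ Finset.univ.erase s,
        (vertexIdem K h (v s) * a t) • x t := by
      rw [← eq_neg_of_add_eq_zero_left h1, ← mul_smul, Units.inv_mul_cancel_left]
      exact (hx s).symm
    rw [h2]
    refine Submodule.smul_mem _ _ (neg_mem (Submodule.sum_mem _ fun t ht =>
      Submodule.smul_mem _ _ (Submodule.subset_span ⟨t, Finset.ne_of_mem_erase ht, rfl⟩)))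
  · apply hi
    rw [hU]
    exact mul_mem_longClasses_left _ (pathClass_mem_longClasses p (Nat.one_le_iff_ne_zero.2 hp0))

/-- Any finite generating family splits along the vertex idempotents; a split family of least size
is irredundant. -/
theorem exists_minimal_generators (P : Type u) [AddCommGroup P] [Module 𝔸 P] [Module.Finite 𝔸 P] :
    ∃ (m : ℕ) (v : Fin m → V) (x : Fin m → P), (∀ s, vertexIdem K h (v s) • x s = x s) ∧
      Submodule.span 𝔸 (Set.range x) = ⊤ ∧
      ∀ s, x s ∉ Submodule.span 𝔸 (x '' {t | t ≠ s}) := by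
  classical
  let Good (m : ℕ) : Prop := ∃ (v : Fin m → V) (x : Fin m → P),
    (∀ s, vertexIdem K h (v s) • x s = x s) ∧ Submodule.span 𝔸 (Set.range x) = ⊤
  have good : ∀ {ι : Type} [Fintype ι] (v : ι → V) (x : ι → P),
      (∀ s, vertexIdem K h (v s) • x s = x s) → Submodule.span 𝔸 (Set.range x) = ⊤ →
      Good (Fintype.card ι) := by
    intro ι _ v x hx hspan
    refine ⟨v ∘ (Fintype.equivFin ι).symm, x ∘ (Fintype.equivFin ι).symm, fun s => hx _, ?_⟩
    rw [EquivLike.range_comp, hspan]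
  have hex : ∃ m, Good m := by
    obtain ⟨n, g, hg⟩ := Module.Finite.exists_fin (R := 𝔸) (M := P)
    refine ⟨_, good (ι := Fin n × V) (fun q => q.2) (fun q => vertexIdem K h q.2 • g q.1)
      (fun q => by rw [← mul_smul, vertexIdem_mul_self]) ?_⟩
    rw [eq_top_iff, ← hg, Submodule.span_le]
    rintro _ ⟨i, rfl⟩
    have : g i = ∑ k : V, vertexIdem K h k • g i := by
      rw [← Finset.sum_smul, sum_vertexIdem, one_smul]
    rw [this]
    exact Submodule.sum_mem _ fun k _ => Submodule.subset_span ⟨(i, k), rfl⟩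
  obtain ⟨v, x, hx, hspan⟩ := Nat.find_spec hex
  refine ⟨_, v, x, hx, hspan, fun s hs => ?_⟩
  have hgood : Good (Fintype.card {t // t ≠ s}) := by
    refine good (fun t => v t) (fun t => x t) (fun t => hx t) ?_
    have hr : (Set.range fun t : {t // t ≠ s} => x t) = x '' {t | t ≠ s} := by
      ext p
      simp
    rw [hr, eq_top_iff]
    refine hspan.ge.trans (Submodule.span_le.2 ?_)
    rintro _ ⟨t, rfl⟩
    by_cases hts : t = s
    · rw [hts]
      exact hs
    · exact Submodule.subset_span ⟨t, hts, rfl⟩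
  have hlt : Fintype.card {t // t ≠ s} < Nat.find hex := by
    have := Fintype.card_subtype_lt (p := fun t => t ≠ s) (x := s) (by simp)
    rwa [Fintype.card_fin] at this
  exact Nat.find_min hex hlt hgood

/-- A finitely generated projective module is a direct sum of modules `P_v`. -/
theorem exists_projCoords [ChainQuiver V] (P : Type u) [AddCommGroup P] [Module 𝔸 P]
    [Module.Finite 𝔸 P] [Module.Projective 𝔸 P] :
    ∃ (m : ℕ) (v : Fin m → V), Nonempty (ProjCoords K h P v) := by
  obtain ⟨m, v, x, hx, hspan, hmin⟩ := exists_minimal_generators (K := K) (V := V) (h := h) P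
  have hsurj : Function.Surjective (Fintype.linearCombination 𝔸 x) := by
    rw [← LinearMap.range_eq_top, Fintype.range_linearCombination, hspan]
  obtain ⟨ι, hι⟩ := Module.projective_lifting_property (Fintype.linearCombination 𝔸 x)
    LinearMap.id hsurj
  let ξ (s : Fin m) : P →ₗ[𝔸] 𝔸 :=
    (LinearMap.toSpanSingleton 𝔸 𝔸 (vertexIdem K h (v s))).comp ((LinearMap.proj s).comp ι)
  have hξ : ∀ s p, ξ s p = ι p s * vertexIdem K h (v s) := fun s p => rfl
  have hsum : ∀ p, ∑ s, ξ s p • x s = p := by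
    intro p
    have := congrArg (fun χ => χ p) hι
    simp only [LinearMap.comp_apply, Fintype.linearCombination_apply, LinearMap.id_apply] at this
    conv_rhs => rw [← this]
    refine Finset.sum_congr rfl fun s _ => ?_
    rw [hξ, mul_smul, hx]
  -- The matrix `D` measures how far the functions `ξ s` are from being coordinates. Its rows are
  -- relations between minimal generators, so its entries lie in the radical. Since `D` is also
  -- idempotent, they lie in every power of the radical and vanish.
  let D (t s : Fin m) : 𝔸 := (if t = s then vertexIdem K h (v s) else 0) - ξ s (x t)
  have hDv : ∀ t s, D t s * vertexIdem K h (v s) = D t s := by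
    intro t s
    simp only [D, sub_mul, hξ, mul_assoc, vertexIdem_mul_self, ite_mul, zero_mul]
  have hDx : ∀ t, ∑ s, D t s • x s = 0 := by
    intro t
    simp only [D, sub_smul, Finset.sum_sub_distrib, hsum, ite_smul, zero_smul,
      Finset.sum_ite_eq, Finset.mem_univ, if_true, hx, sub_self]
  have hD1 : ∀ t s, D t s ∈ longClasses K V h 1 := fun t s =>
    mem_longClasses_of_minimal hx hmin (hDx t) (hDv t) s
  have hDD : ∀ r s, D r s = ∑ t, D r t * D t s := by
    intro r s
    have h1 : ∑ t, D r t * ξ s (x t) = 0 := by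
      have := congrArg (ξ s) (hDx r)
      simpa only [map_sum, map_smul, map_zero, smul_eq_mul] using this
    have h2 : ∀ t, D r t * D t s
        = (if t = s then D r t * vertexIdem K h (v s) else 0) - D r t * ξ s (x t) := by
      intro t
      rw [← mul_ite_zero, ← mul_sub]
    simp only [h2, Finset.sum_sub_distrib, h1, sub_zero, Finset.sum_ite_eq', Finset.mem_univ,
      if_true, hDv]
  have hDm : ∀ k r s, D r s ∈ longClasses K V h k := by
    intro k
    induction k with
    | zero => exact fun r s => mem_longClasses_zero _
    | succ k ih =>
      intro r s
      rw [hDD]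
      exact Submodule.sum_mem _ fun t _ => mul_mem_longClasses (ih r t) (hD1 t s)
  refine ⟨m, v, ⟨⟨x, ξ, hsum, fun s t => ?_⟩⟩⟩
  exact (sub_eq_zero.1 (eq_zero_of_mem_longClasses le_rfl (hDm h t s))).symm

end Coordinates

/-! ### Paths inverted by a ring homomorphism -/

section Inverts

set_option linter.unusedSectionVars false

variable {K : Type u} [Field K] {V : Type} [Quiver.{0} V] [Fintype V] [DecidableEq V] {h : ℕ}

local notation "𝔸" => TruncatedPathAlgebra K V h

/-- The homomorphism `f` turns right multiplication by the path `p` into an isomorphism. -/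
def Inverts {B : Type u} [Ring B] (f : TruncatedPathAlgebra K V h →+* B) {j i : V}
    (p : Quiver.Path j i) : Prop :=
  ∃ b, f (pathClass K h p) * b = f (vertexIdem K h i) ∧
    b * f (pathClass K h p) = f (vertexIdem K h j)

theorem vertexIdem_mem (v : V) : vertexIdem K h v ∈ vertexProj K h v :=
  pathClass_mem (K := K) (h := h) Quiver.Path.nil

theorem mul_vertexIdem_of_mem {v : V} {x : 𝔸} (hx : x ∈ vertexProj K h v) :
    x * vertexIdem K h v = x := by
  obtain ⟨a, rfl⟩ := Submodule.mem_span_singleton.1 hx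
  rw [smul_eq_mul]
  change a * vertexIdem K h v * vertexIdem K h v = a * vertexIdem K h v
  rw [mul_assoc, vertexIdem_mul_self]

variable (K h) in
/-- The coordinate on `P_v`. -/
noncomputable def vertexCoords (v : V) : ProjCoords K h (vertexProj K h v) (fun _ : Fin 1 => v) where
  gen _ := ⟨vertexIdem K h v, vertexIdem_mem v⟩
  coord _ := (vertexProj K h v).subtype
  sum_coord p := by
    ext
    simp [mul_vertexIdem_of_mem p.2]
  coord_gen s t := by simp [Subsingleton.elim t s]

instance (v : V) : Module.Finite 𝔸 (vertexProj K h v) :=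
  Module.Finite.iff_fg.2 (Submodule.fg_span_singleton _)

instance (v : V) : Module.Projective 𝔸 (vertexProj K h v) := by
  refine Module.Projective.of_split (vertexProj K h v).subtype
    ((LinearMap.toSpanSingleton 𝔸 𝔸 (vertexIdem K h v)).codRestrict _ fun x =>
      Submodule.smul_mem _ x (vertexIdem_mem v)) ?_
  ext x
  exact mul_vertexIdem_of_mem x.2

theorem uniquelySolvable_one_iff {B : Type u} [Ring B] {N : Type u} [AddCommGroup N] [Module B N]
    (e e' a : B) :
    UniquelySolvable N (fun _ : Fin 1 => e) (fun _ : Fin 1 => e') (fun _ _ => a) ↔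
      ActsBijectively N e e' a := by
  constructor
  · intro H y hy
    obtain ⟨x, ⟨hx, hxy⟩, hu⟩ := H (fun _ => y) (fun _ => hy)
    refine ⟨x 0, ⟨hx 0, by simpa using hxy 0⟩, fun z hz => ?_⟩
    exact congrFun (hu (fun _ => z) ⟨fun _ => hz.1, fun _ => by simpa using hz.2⟩) 0
  · intro H y hy
    obtain ⟨x, ⟨hx, hxy⟩, hu⟩ := H (y 0) (hy 0)
    refine ⟨fun _ => x, ⟨fun _ => hx, fun s => by simpa [Subsingleton.elim s 0] using hxy⟩,
      fun z hz => ?_⟩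
    funext t
    rw [Subsingleton.elim t 0]
    exact hu (z 0) ⟨hz.1 0, by simpa using hz.2 0⟩

variable {B : Type u} [Ring B] (f : TruncatedPathAlgebra K V h →+* B)

theorem bijective_map_pathMap_iff {j i : V} (p : Quiver.Path j i) :
    Function.Bijective (BaseChange.map f (pathMap K h p)) ↔ Inverts f p := by
  rw [BaseChange.bijective_map_iff, Inverts, exists_inverse_iff_actsBijectively
    (by rw [← map_mul, vertexIdem_mul_self]) (by rw [← map_mul, vertexIdem_mul_self])
    (by rw [← map_mul, vertexIdem_mul_pathClass]) (by rw [← map_mul, pathClass_mul_vertexIdem])]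
  refine forall_congr' fun N => forall_congr' fun _ => forall_congr' fun _ => ?_
  rw [(vertexCoords K h i).bijective_comp_iff f (vertexCoords K h j), ← uniquelySolvable_one_iff]
  have : (vertexProj K h j).subtype (pathMap K h p ⟨vertexIdem K h i, vertexIdem_mem i⟩)
      = pathClass K h p :=
    vertexIdem_mul_pathClass p
  simp only [vertexCoords, this]

theorem subsingleton_baseChange_vertexProj_iff (k : V) :
    Subsingleton (BaseChange f (vertexProj K h k)) ↔ f (vertexIdem K h k) = 0 := by
  rw [BaseChange.subsingleton_iff]
  constructor
  · intro H
    have h1 := H B ((vertexCoords K h k).extend f fun _ => f (vertexIdem K h k))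
    have h2 := (vertexCoords K h k).extend_gen f (fun _ => f (vertexIdem K h k))
      (fun _ => by rw [smul_eq_mul, ← map_mul, vertexIdem_mul_self]) 0
    rw [h1] at h2
    exact h2.symm
  · intro H N _ _ φ
    apply (vertexCoords K h k).hom_ext
    intro t
    rw [← (vertexCoords K h k).map_gen_fixed φ t, H, zero_smul, LinearMap.zero_apply]

/-- Hence annihilating a vertex is itself a localisation, namely at the zero endomorphism of `P_k`.
-/
theorem bijective_map_zero_iff (k : V) :
    Function.Bijective (BaseChange.map f (0 : vertexProj K h k →ₗ[𝔸] vertexProj K h k)) ↔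
      f (vertexIdem K h k) = 0 := by
  rw [← subsingleton_baseChange_vertexProj_iff]
  have h0 : BaseChange.map f (0 : vertexProj K h k →ₗ[𝔸] vertexProj K h k) = 0 := by
    apply BaseChange.hom_ext
    intro m
    simp
  rw [h0]
  constructor
  · intro H
    exact ⟨fun x y => H.1 rfl⟩
  · intro H
    exact ⟨fun x y _ => Subsingleton.elim x y, fun y => ⟨0, Subsingleton.elim _ _⟩⟩

variable {f}

/-- As `U` commutes with the idempotent at `j`, multiplication by it restricts to an automorphism of
`P_j`, so it does not affect invertibility between the corners. -/
theorem IsUnitMulPath.exists_inverse_iff {i j : V} {x : 𝔸} {p : Quiver.Path j i}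
    (hx : IsUnitMulPath x p) :
    (∃ b, f x * b = f (vertexIdem K h i) ∧ b * f x = f (vertexIdem K h j)) ↔ Inverts f p := by
  obtain ⟨U, rfl, hU⟩ := hx.right
  have h1 : f (U : 𝔸) * f (↑U⁻¹ : 𝔸) = 1 := by rw [← map_mul, Units.mul_inv, map_one]
  have h2 : f (↑U⁻¹ : 𝔸) * f (U : 𝔸) = 1 := by rw [← map_mul, Units.inv_mul, map_one]
  have hU' : f (U : 𝔸) * f (vertexIdem K h j) = f (vertexIdem K h j) * f (U : 𝔸) := by
    rw [← map_mul, hU.eq, map_mul]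
  constructor
  · rintro ⟨b, hb, hb'⟩
    refine ⟨f (U : 𝔸) * b, by rw [← hb, map_mul, mul_assoc], ?_⟩
    rw [map_mul] at hb'
    calc f (U : 𝔸) * b * f (pathClass K h p)
        = f (U : 𝔸) * (b * (f (pathClass K h p) * f (U : 𝔸))) * f (↑U⁻¹ : 𝔸) := by
          simp only [mul_assoc, h1, mul_one]
      _ = f (vertexIdem K h j) := by rw [hb', hU', mul_assoc, h1, mul_one]
  · rintro ⟨b, hb, hb'⟩
    refine ⟨f (↑U⁻¹ : 𝔸) * b, ?_, ?_⟩
    · rw [map_mul, mul_assoc, ← mul_assoc (f (U : 𝔸)), h1, one_mul, hb]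
    · rw [map_mul, mul_assoc, ← mul_assoc b, hb', ← hU', ← mul_assoc, h2, one_mul]

/-- The end of the elimination. A zero matrix is uniquely solvable only if all admissible right-hand
sides and all admissible unknowns vanish, so every vertex involved is annihilated by `f`, hence by
`g`. -/
theorem uniquelySolvable_transfer_of_eq_zero {C : Type u} [Ring C]
    {g : TruncatedPathAlgebra K V h →+* C}
    (hkill : ∀ k, f (vertexIdem K h k) = 0 → g (vertexIdem K h k) = 0) {m l : ℕ}
    (v : Fin m → V) (w : Fin l → V) (M : Fin m → Fin l → 𝔸) (hM : ∀ s t, M s t = 0)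
    (H : ∀ (N : Type u) [AddCommGroup N] [Module B N], UniquelySolvable N
      (fun s => f (vertexIdem K h (v s))) (fun t => f (vertexIdem K h (w t)))
      (fun s t => f (M s t)))
    (N : Type u) [AddCommGroup N] [Module C N] :
    UniquelySolvable N (fun s => g (vertexIdem K h (v s))) (fun t => g (vertexIdem K h (w t)))
      (fun s t => g (M s t)) := by
  have hfix : ∀ k : V, f (vertexIdem K h k) • f (vertexIdem K h k) = f (vertexIdem K h k) :=
    fun k => by rw [smul_eq_mul, ← map_mul, vertexIdem_mul_self]
  have hv : ∀ s, g (vertexIdem K h (v s)) = 0 := by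
    intro s
    obtain ⟨x, ⟨-, hx⟩, -⟩ := H B (fun s => f (vertexIdem K h (v s))) (fun s => hfix _)
    have := hx s
    simp only [hM, map_zero, zero_smul, Finset.sum_const_zero] at this
    exact hkill _ this.symm
  have hw : ∀ t, g (vertexIdem K h (w t)) = 0 := by
    intro t
    obtain ⟨x, -, hx⟩ := H B 0 (fun s => smul_zero _)
    have h1 := hx 0 ⟨fun t => smul_zero _, fun s => by simp⟩
    have h2 := hx (fun t => f (vertexIdem K h (w t))) ⟨fun t => hfix _, fun s => by simp [hM]⟩
    exact hkill _ (congrFun (h2.trans h1.symm) t)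
  intro y hy
  simp only [hv, zero_smul] at hy
  refine ⟨0, ⟨fun t => smul_zero _, fun s => by simp [← hy s]⟩, ?_⟩
  rintro x ⟨hx, -⟩
  funext t
  simp only [hw, zero_smul] at hx
  exact (hx t).symm

/-- Whether a linear system is uniquely solvable depends only on the inverted paths and the
annihilated vertices. -/
theorem uniquelySolvable_transfer [ChainQuiver V] {C : Type u} [Ring C]
    {g : TruncatedPathAlgebra K V h →+* C}
    (hinv : ∀ {j i : V} (p : Quiver.Path j i), Inverts f p → Inverts g p)
    (hkill : ∀ k, f (vertexIdem K h k) = 0 → g (vertexIdem K h k) = 0) {m l : ℕ}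
    (v : Fin m → V) (w : Fin l → V) (M : Fin m → Fin l → 𝔸)
    (hM : ∀ s t, vertexIdem K h (v s) * M s t * vertexIdem K h (w t) = M s t)
    (H : ∀ (N : Type u) [AddCommGroup N] [Module B N], UniquelySolvable N
      (fun s => f (vertexIdem K h (v s))) (fun t => f (vertexIdem K h (w t)))
      (fun s t => f (M s t)))
    (N : Type u) [AddCommGroup N] [Module C N] :
    UniquelySolvable N (fun s => g (vertexIdem K h (v s))) (fun t => g (vertexIdem K h (w t)))
      (fun s t => g (M s t)) := by
  by_cases h0 : ∀ s t, M s t = 0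
  · exact uniquelySolvable_transfer_of_eq_zero hkill v w M h0 H N
  push Not at h0
  induction m generalizing l with
  | zero => exact h0.choose.elim0
  | succ m ih =>
  cases l with
  | zero => exact h0.choose_spec.choose.elim0
  | succ l =>
  classical
  obtain ⟨s₁, t₁, hst⟩ := h0
  -- The pivot is an entry whose path is shortest in the whole matrix, so that it divides its row
  -- and its column.
  let Q (k : ℕ) : Prop := ∃ s t, ∃ p : Quiver.Path (w t) (v s), IsUnitMulPath (M s t) p ∧
    p.length = k
  have hex : ∃ k, Q k := by
    obtain ⟨p, hp⟩ := exists_isUnitMulPath (hM s₁ t₁) hst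
    exact ⟨_, s₁, t₁, p, hp, rfl⟩
  obtain ⟨s₀, t₀, p, hp, hpk⟩ := Nat.find_spec hex
  have hmin : ∀ s t, ∀ q : Quiver.Path (w t) (v s), IsUnitMulPath (M s t) q →
      p.length ≤ q.length := by
    intro s t q hq
    rw [hpk]
    exact Nat.find_min' hex ⟨s, t, q, hq, rfl⟩
  have hleft : ∀ s t, vertexIdem K h (v s) * M s t = M s t := by
    intro s t
    rw [← hM s t, ← mul_assoc, ← mul_assoc, vertexIdem_mul_self]
  have hright : ∀ s t, M s t * vertexIdem K h (w t) = M s t := by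
    intro s t
    rw [← hM s t, mul_assoc, vertexIdem_mul_self]
  have hc : ∀ t, ∃ c, M s₀ t = M s₀ t₀ * c ∧ vertexIdem K h (w t₀) * c = c ∧
      c * vertexIdem K h (w t) = c := by
    intro t
    have : ∃ c, M s₀ t = M s₀ t₀ * c := by
      by_cases hz : M s₀ t = 0
      · exact ⟨0, by rw [hz, mul_zero]⟩
      · obtain ⟨q, hq⟩ := exists_isUnitMulPath (hM s₀ t) hz
        exact hp.exists_eq_mul hq (hmin _ _ q hq)
    obtain ⟨c, hc⟩ := this
    -- Cutting `c` down by the idempotents keeps the entries of the reduced matrix in the right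
    -- corners, as the induction requires.
    refine ⟨vertexIdem K h (w t₀) * c * vertexIdem K h (w t), ?_, ?_, ?_⟩
    · rw [← mul_assoc, ← mul_assoc, hright, ← hc, hright]
    · rw [← mul_assoc, ← mul_assoc, vertexIdem_mul_self]
    · rw [mul_assoc, vertexIdem_mul_self]
  have hd : ∀ s, ∃ d, M s t₀ = d * M s₀ t₀ ∧ vertexIdem K h (v s) * d = d := by
    intro s
    have : ∃ d, M s t₀ = d * M s₀ t₀ := by
      by_cases hz : M s t₀ = 0
      · exact ⟨0, by rw [hz, zero_mul]⟩
      · obtain ⟨q, hq⟩ := exists_isUnitMulPath (hM s t₀) hz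
        exact hp.exists_mul_eq hq (hmin _ _ q hq)
    obtain ⟨d, hd⟩ := this
    refine ⟨vertexIdem K h (v s) * d, ?_, ?_⟩
    · rw [mul_assoc, ← hd, hleft]
    · rw [← mul_assoc, vertexIdem_mul_self]
  choose c hc hc' hc'' using hc
  choose d hd hd' using hd
  -- The coefficients `c` and `d` live in the path algebra, so one elimination serves both `f` and
  -- `g`.
  have elim : ∀ {B : Type u} [Ring B] (f : TruncatedPathAlgebra K V h →+* B) (N : Type u)
      [AddCommGroup N] [Module B N],
      UniquelySolvable N (fun s => f (vertexIdem K h (v s))) (fun t => f (vertexIdem K h (w t)))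
        (fun s t => f (M s t)) ↔
      ActsBijectively N (f (vertexIdem K h (v s₀))) (f (vertexIdem K h (w t₀))) (f (M s₀ t₀)) ∧
      UniquelySolvable N (fun s => f (vertexIdem K h (v (s₀.succAbove s))))
        (fun t => f (vertexIdem K h (w (t₀.succAbove t))))
        (fun s t => f (M (s₀.succAbove s) (t₀.succAbove t)
          - d (s₀.succAbove s) * M s₀ t₀ * c (t₀.succAbove t))) := by
    intro B _ f N _ _
    rw [uniquelySolvable_iff_eliminate s₀ t₀ (fun t => f (c (t₀.succAbove t)))
      (fun s => f (d (s₀.succAbove s)))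
      (fun t => by rw [← map_mul, ← hc]) (fun t => by rw [← map_mul, hc'])
      (fun s => by rw [← map_mul, ← hd]) (fun s => by rw [← map_mul, hd'])]
    simp only [map_sub, map_mul]
  have inverse : ∀ {B : Type u} [Ring B] (f : TruncatedPathAlgebra K V h →+* B),
      (∀ (N : Type u) [AddCommGroup N] [Module B N], ActsBijectively N
        (f (vertexIdem K h (v s₀))) (f (vertexIdem K h (w t₀))) (f (M s₀ t₀))) ↔
      Inverts f p := by
    intro B _ f
    rw [← exists_inverse_iff_actsBijectively (by rw [← map_mul, vertexIdem_mul_self])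
      (by rw [← map_mul, vertexIdem_mul_self]) (by rw [← map_mul, hleft])
      (by rw [← map_mul, hright]), hp.exists_inverse_iff]
  refine (elim g N).2 ⟨?_, ?_⟩
  · exact (inverse g).2 (hinv p ((inverse f).1 fun N _ _ => ((elim f N).1 (H N)).1)) N
  · have hM' : ∀ s t, vertexIdem K h (v (s₀.succAbove s)) *
        (M (s₀.succAbove s) (t₀.succAbove t)
          - d (s₀.succAbove s) * M s₀ t₀ * c (t₀.succAbove t)) *
        vertexIdem K h (w (t₀.succAbove t)) = M (s₀.succAbove s) (t₀.succAbove t)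
          - d (s₀.succAbove s) * M s₀ t₀ * c (t₀.succAbove t) := by
      intro s t
      rw [mul_sub, sub_mul, hM, ← mul_assoc, ← mul_assoc, hd', mul_assoc _ (c _), hc'']
    have H' := fun (N : Type u) (_ : AddCommGroup N) (_ : Module B N) => ((elim f N).1 (H N)).2
    by_cases hz : ∀ s t, M (s₀.succAbove s) (t₀.succAbove t)
          - d (s₀.succAbove s) * M s₀ t₀ * c (t₀.succAbove t) = 0
    · exact uniquelySolvable_transfer_of_eq_zero hkill (fun s => v (s₀.succAbove s))
        (fun t => w (t₀.succAbove t)) _ hz H' N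
    · push Not at hz
      exact ih (fun s => v (s₀.succAbove s)) (fun t => w (t₀.succAbove t)) _ hM' H' hz

/-- Whether `B ⊗ σ` is invertible depends only on the inverted paths and the annihilated
vertices. -/
theorem bijective_map_transfer [ChainQuiver V] {C : Type u} [Ring C]
    {g : TruncatedPathAlgebra K V h →+* C}
    (hinv : ∀ {j i : V} (p : Quiver.Path j i), Inverts f p → Inverts g p)
    (hkill : ∀ k, f (vertexIdem K h k) = 0 → g (vertexIdem K h k) = 0) (σ : ProjMap 𝔸)
    (H : Function.Bijective (BaseChange.map f σ.hom)) :
    Function.Bijective (BaseChange.map g σ.hom) := by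
  obtain ⟨m, v, ⟨c⟩⟩ := exists_projCoords (K := K) (V := V) (h := h) σ.P
  obtain ⟨l, w, ⟨d⟩⟩ := exists_projCoords (K := K) (V := V) (h := h) σ.Q
  rw [BaseChange.bijective_map_iff] at H ⊢
  intro N _ _
  rw [c.bijective_comp_iff g d]
  refine uniquelySolvable_transfer hinv hkill v w _ (fun s t => ?_) (fun N _ _ => ?_) N
  · rw [mul_assoc, d.coord_mul_vertexIdem, ← smul_eq_mul, ← map_smul, ← map_smul,
      c.vertexIdem_smul_gen]
  · rw [← c.bijective_comp_iff f d]
    exact H N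

end Inverts

/-! ### Calculus of inverted paths: composition, overlaps, annihilated vertices, bounds on the
length -/

section Links

set_option linter.unusedSectionVars false

variable {K : Type u} [Field K] {V : Type} [Quiver.{0} V] [Fintype V] [DecidableEq V] {h : ℕ}
  {B : Type u} [Ring B] {f : TruncatedPathAlgebra K V h →+* B}

open Quiver (Path)

namespace Inverts

theorem map_comp {j k i : V} (p : Path j k) (q : Path k i) :
    f (pathClass K h (p.comp q)) = f (pathClass K h q) * f (pathClass K h p) := by
  rw [← map_mul, pathClass_mul_pathClass]

theorem map_mul_idem {j i : V} (p : Path j i) :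
    f (pathClass K h p) * f (vertexIdem K h j) = f (pathClass K h p) := by
  rw [← map_mul, pathClass_mul_vertexIdem]

theorem idem_mul_map {j i : V} (p : Path j i) :
    f (vertexIdem K h i) * f (pathClass K h p) = f (pathClass K h p) := by
  rw [← map_mul, vertexIdem_mul_pathClass]

theorem nil (j : V) : Inverts f (Path.nil : Path j j) :=
  ⟨f (vertexIdem K h j), map_mul_idem _, idem_mul_map _⟩

theorem comp {j k i : V} {p : Path j k} {q : Path k i} (hp : Inverts f p) (hq : Inverts f q) :
    Inverts f (p.comp q) := by
  obtain ⟨b, hb, hb'⟩ := hp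
  obtain ⟨c, hc, hc'⟩ := hq
  refine ⟨b * c, ?_, ?_⟩
  · rw [map_comp, mul_assoc, ← mul_assoc _ b, hb, ← mul_assoc, map_mul_idem, hc]
  · rw [map_comp, mul_assoc, ← mul_assoc c, hc', idem_mul_map, hb']

theorem of_left_right {j i : V} {p : Path j i} {b c : B}
    (hb : b * f (pathClass K h p) = f (vertexIdem K h j))
    (hc : f (pathClass K h p) * c = f (vertexIdem K h i)) : Inverts f p := by
  refine ⟨f (vertexIdem K h j) * c, by rw [← mul_assoc, map_mul_idem, hc], ?_⟩
  rw [← hb, mul_assoc b, hc, mul_assoc, idem_mul_map, hb]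

theorem of_comp_left {j k i : V} {p : Path j k} {q : Path k i} (hpq : Inverts f (p.comp q))
    (hq : Inverts f q) : Inverts f p := by
  obtain ⟨b, hb, hb'⟩ := hpq
  obtain ⟨c, hc, hc'⟩ := hq
  rw [map_comp] at hb hb'
  refine of_left_right (b := b * f (pathClass K h q)) (c := b * f (pathClass K h q))
    (by rw [mul_assoc, hb']) ?_
  calc f (pathClass K h p) * (b * f (pathClass K h q))
      = c * (f (pathClass K h q) * f (pathClass K h p) * b) * f (pathClass K h q) := by
        conv_lhs => rw [← idem_mul_map p, ← hc']
        simp only [mul_assoc]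
    _ = f (vertexIdem K h k) := by rw [hb, mul_assoc, idem_mul_map, hc']

theorem of_comp_right {j k i : V} {p : Path j k} {q : Path k i} (hpq : Inverts f (p.comp q))
    (hp : Inverts f p) : Inverts f q := by
  obtain ⟨b, hb, hb'⟩ := hpq
  obtain ⟨c, hc, hc'⟩ := hp
  rw [map_comp] at hb hb'
  refine of_left_right (b := f (pathClass K h p) * b) (c := f (pathClass K h p) * b) ?_
    (by rw [← mul_assoc, hb])
  calc f (pathClass K h p) * b * f (pathClass K h q)
      = f (pathClass K h p) * (b * (f (pathClass K h q) * f (pathClass K h p))) * c := by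
        conv_lhs => rw [← map_mul_idem q, ← hc]
        simp only [mul_assoc]
    _ = f (vertexIdem K h k) := by rw [hb', map_mul_idem, hc]

/-- If two overlapping paths are inverted, then so are the three pieces. -/
theorem overlap {a b c d : V} {p : Path a b} {q : Path b c} {r : Path c d}
    (hpq : Inverts f (p.comp q)) (hqr : Inverts f (q.comp r)) :
    Inverts f p ∧ Inverts f q ∧ Inverts f r := by
  -- The inverse of the first composite gives a right inverse of `q`, that of the second a left
  -- inverse.
  have hq : Inverts f q := by
    obtain ⟨x, hx, -⟩ := hpq
    obtain ⟨y, -, hy⟩ := hqr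
    rw [map_comp, mul_assoc] at hx
    rw [map_comp, ← mul_assoc] at hy
    exact of_left_right hy hx
  exact ⟨hpq.of_comp_left hq, hq, hqr.of_comp_right hq⟩

theorem killed_iff {j i : V} {p : Path j i} (hp : Inverts f p) :
    f (vertexIdem K h j) = 0 ↔ f (vertexIdem K h i) = 0 := by
  obtain ⟨b, hb, hb'⟩ := hp
  constructor
  · intro h0
    rw [← hb, ← map_mul_idem, h0, mul_zero, zero_mul]
  · intro h0
    rw [← hb', ← idem_mul_map, h0, zero_mul, mul_zero]

theorem of_killed {j i : V} (p : Path j i) (hj : f (vertexIdem K h j) = 0)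
    (hi : f (vertexIdem K h i) = 0) : Inverts f p :=
  ⟨0, by rw [mul_zero, hi], by rw [zero_mul, hj]⟩

theorem killed_of_middle {j k i : V} {p : Path j k} {q : Path k i} (hpq : Inverts f (p.comp q))
    (hk : f (vertexIdem K h k) = 0) : f (vertexIdem K h j) = 0 := by
  obtain ⟨b, hb, hb'⟩ := hpq
  rw [← hb', map_comp, ← idem_mul_map p, hk, zero_mul, mul_zero, mul_zero]

theorem length_lt {j i : V} {p : Path j i} (hp : Inverts f p) (hj : f (vertexIdem K h j) ≠ 0) :
    p.length < h := by
  by_contra hlen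
  obtain ⟨b, -, hb⟩ := hp
  rw [pathClass_eq_zero p (not_lt.1 hlen), map_zero, mul_zero] at hb
  exact hj hb.symm

/-- A longer path starts with a closed path `c` of positive length. Then `c` is left invertible and
so are all its powers, but sufficiently high powers vanish. -/
theorem length_lt_card [ChainQuiver V] {j i : V} {p : Path j i} (hp : Inverts f p)
    (hj : f (vertexIdem K h j) ≠ 0) : p.length < Fintype.card V := by
  by_contra hlen
  obtain ⟨c, q, hc, rfl⟩ := ChainQuiver.exists_cycle p (not_lt.1 hlen)
  obtain ⟨b, -, hb⟩ := hp
  rw [map_comp, ← mul_assoc] at hb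
  have key : ∀ m : ℕ, ∃ (r : Path j j) (d : B), m ≤ r.length ∧
      d * f (pathClass K h r) = f (vertexIdem K h j) := by
    intro m
    induction m with
    | zero => exact ⟨Path.nil, _, Nat.zero_le _, idem_mul_map Path.nil⟩
    | succ m ih =>
      obtain ⟨r, d, hr, hd⟩ := ih
      refine ⟨r.comp c, d * (b * f (pathClass K h q)), ?_, ?_⟩
      · rw [Path.length_comp]
        omega
      · rw [map_comp, mul_assoc, ← mul_assoc _ _ (f (pathClass K h r)), hb, idem_mul_map, hd]
  obtain ⟨r, d, hr, hd⟩ := key h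
  rw [pathClass_eq_zero r hr, map_zero, mul_zero] at hd
  exact hj hd.symm

theorem map {C : Type u} [Ring C] (g : B →+* C) {j i : V} {p : Path j i} (hp : Inverts f p) :
    Inverts (g.comp f) p := by
  obtain ⟨b, hb, hb'⟩ := hp
  exact ⟨g b, by simp [← map_mul, hb], by simp [← map_mul, hb']⟩

end Inverts

/-! ### The arcs attached to a ring homomorphism -/

/-- The vertices on the arc `a`. -/
def arcSupport (a : V × V) : Set V :=
  {x | ∃ (u : Path a.1 x) (v : Path x a.2), u.length + v.length < Fintype.card V}

/-- The vertices on the arc `a` other than its end points. -/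
def arcInner (a : V × V) : Set V := {x | x ∈ arcSupport a ∧ x ≠ a.1 ∧ x ≠ a.2}

variable (f) in
/-- There is a path from `j` to `i` that is inverted by `f`. -/
def Linked (j i : V) : Prop := ∃ p : Path j i, Inverts f p

variable (f) in
/-- The arc `a` joins two different vertices that are not annihilated, and it is a maximal link. -/
def IsMaximalLink (a : V × V) : Prop :=
  a.1 ≠ a.2 ∧ f (vertexIdem K h a.1) ≠ 0 ∧ Linked f a.1 a.2 ∧
    (∀ x, x ≠ a.1 → ¬ Linked f x a.1) ∧ ∀ y, y ≠ a.2 → ¬ Linked f a.2 y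

variable (f) in
/-- The vertex `k` is annihilated, or it is an intermediate term of a link. -/
def IsLoopVertex (k : V) : Prop :=
  f (vertexIdem K h k) = 0 ∨ ((∃ x, x ≠ k ∧ Linked f x k) ∧ ∃ y, y ≠ k ∧ Linked f k y)

variable (f) in
/-- The maximal links and the loops attached to `f`. -/
def linkArcs : Set (V × V) := {a | IsMaximalLink f a} ∪ {a | a.1 = a.2 ∧ IsLoopVertex f a.1}

theorem UnivLoc.arcs_eq_linkArcs (L : UnivLoc (TruncatedPathAlgebra K V h)) :
    L.arcs = linkArcs L.hom := by
  have h1 : ∀ k, L.Kills k ↔ L.hom (vertexIdem K h k) = 0 := fun k =>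
    subsingleton_baseChange_vertexProj_iff L.hom k
  have h2 : ∀ j i, L.Links j i ↔ Linked L.hom j i := fun j i =>
    exists_congr fun p => bijective_map_pathMap_iff L.hom p
  simp only [UnivLoc.arcs, linkArcs, IsMaximalLink, IsLoopVertex, h1, h2, ne_eq]

theorem mem_linkArcs_of_ne {a : V × V} (hne : a.1 ≠ a.2) :
    a ∈ linkArcs f ↔ IsMaximalLink f a := by
  constructor
  · rintro (ha | ha)
    · exact ha
    · exact absurd ha.1 hne
  · exact Or.inl

theorem mem_linkArcs_self {k : V} : (k, k) ∈ linkArcs f ↔ IsLoopVertex f k := by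
  constructor
  · rintro (ha | ha)
    · exact absurd rfl ha.1
    · exact ha.2
  · exact fun hk => Or.inr ⟨rfl, hk⟩

variable [ChainQuiver V]

theorem arcSupport_self (k : V) : arcSupport (k, k) ⊆ {k} := by
  rintro x ⟨u, v, huv⟩
  have := ChainQuiver.length_eq_zero (u.comp v) (by rwa [Path.length_comp])
  rw [Path.length_comp] at this
  exact (Path.eq_of_length_zero u (by omega)).symm

/-- Short paths with given end points are unique, so the composite is the inverted path of the link
itself. -/
theorem IsMaximalLink.inverts_comp {a : V × V} (ha : IsMaximalLink f a) {x : V} {u : Path a.1 x}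
    {v : Path x a.2} (huv : u.length + v.length < Fintype.card V) : Inverts f (u.comp v) := by
  obtain ⟨p, hp⟩ := ha.2.2.1
  rwa [Path.eq_of_length_lt_card (p := u.comp v) (by rwa [Path.length_comp])
    (hp.length_lt_card ha.2.1)]

/-- The path `w` says that `b` starts on `a`, at or after its source. If `b` reaches the end of `a`
or passes it, the overlap rule inverts both protruding pieces; by maximality they are trivial and `a
= b`. Otherwise `b` is a piece of `a`. A common end point would, by two-out-of-three, invert the
rest of `a` and extend the link `b`. -/
theorem IsMaximalLink.support_subset_inner {a b : V × V} (ha : IsMaximalLink f a)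
    (hb : IsMaximalLink f b) (hab : a ≠ b) {x : V} {u' : Path b.1 x} {w : Path a.1 b.1}
    {v : Path x a.2} {v' : Path x b.2} (huv : (w.comp u').length + v.length < Fintype.card V)
    (huv' : u'.length + v'.length < Fintype.card V) : arcSupport b ⊆ arcInner a := by
  have hpa := ha.inverts_comp huv
  have hpb := hb.inverts_comp huv'
  -- The path `z` runs from the end of `a` to the end of `b` in the first case, and backwards from
  -- `b` to `a` in the second.
  rcases Path.eq_comp_or_eq_comp_of_source v v' with ⟨z, rfl⟩ | ⟨z, rfl⟩
  · exfalso
    rw [Path.comp_assoc] at hpa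
    rw [← Path.comp_assoc] at hpb
    obtain ⟨hw, -, hz⟩ := hpa.overlap hpb
    apply hab
    refine Prod.ext ?_ ?_
    · by_contra hne
      exact hb.2.2.2.1 _ hne ⟨w, hw⟩
    · by_contra hne
      exact ha.2.2.2.2 _ (Ne.symm hne) ⟨z, hz⟩
  · have hlen : w.length + (u'.length + v'.length) + z.length < Fintype.card V := by
      rw [Path.length_comp, Path.length_comp] at huv
      omega
    have hpa' : Inverts f (w.comp ((u'.comp v').comp z)) := by
      simpa only [Path.comp_assoc] using hpa
    have h1 : w.length ≠ 0 := by
      intro hw0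
      have hz : Inverts f z := by
        have hw : Inverts f w := by
          rcases a with ⟨a1, a2⟩
          have h1 : a1 = b.1 := Path.eq_of_length_zero w hw0
          subst h1
          rw [Path.eq_nil_of_length_zero w hw0]
          exact Inverts.nil _
        exact (hpa'.of_comp_right hw).of_comp_right hpb
      apply hab
      refine Prod.ext (Path.eq_of_length_zero w hw0) ?_
      by_contra hne
      exact hb.2.2.2.2 _ hne ⟨z, hz⟩
    have h2 : z.length ≠ 0 := by
      intro hz0
      have hw : Inverts f w := by
        have hz : Inverts f z := by
          rcases a with ⟨a1, a2⟩
          have h1 : b.2 = a2 := Path.eq_of_length_zero z hz0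
          subst h1
          rw [Path.eq_nil_of_length_zero z hz0]
          exact Inverts.nil _
        rw [← Path.comp_assoc] at hpa'
        exact (hpa'.of_comp_left hz).of_comp_left hpb
      apply hab
      refine Prod.ext ?_ (Path.eq_of_length_zero z hz0).symm
      by_contra hne
      exact hb.2.2.2.1 _ hne ⟨w, hw⟩
    rintro y ⟨s, t, hst⟩
    have hst' : s.length + t.length = u'.length + v'.length := by
      have := Path.eq_of_length_lt_card (p := s.comp t) (q := u'.comp v')
        (by rwa [Path.length_comp]) (by rwa [Path.length_comp])
      rw [← Path.length_comp, ← Path.length_comp, this]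
    refine ⟨⟨w.comp s, t.comp z, ?_⟩, ?_, ?_⟩
    · rw [Path.length_comp, Path.length_comp]
      omega
    · rintro rfl
      have := ChainQuiver.length_eq_zero (w.comp s) (by rw [Path.length_comp]; omega)
      rw [Path.length_comp] at this
      omega
    · rintro rfl
      have := ChainQuiver.length_eq_zero (t.comp z) (by rw [Path.length_comp]; omega)
      rw [Path.length_comp] at this
      omega

theorem IsMaximalLink.nonCrossing {a b : V × V} (ha : IsMaximalLink f a)
    (hb : IsMaximalLink f b) (hab : a ≠ b) : NonCrossing arcSupport arcInner a b := by
  by_cases hd : Disjoint (arcSupport a) (arcSupport b)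
  · exact Or.inl hd
  · obtain ⟨x, ⟨u, v, huv⟩, u', v', huv'⟩ := Set.not_disjoint_iff.1 hd
    rcases Path.eq_comp_or_eq_comp_of_target u u' with ⟨w, rfl⟩ | ⟨w, rfl⟩
    · exact Or.inr (Or.inl (hb.support_subset_inner ha (Ne.symm hab) huv' huv))
    · exact Or.inr (Or.inr (ha.support_subset_inner hb hab huv huv'))

/-- An end point of a maximal link is neither annihilated nor an intermediate term, so a loop vertex
on the arc lies strictly inside. -/
theorem IsMaximalLink.nonCrossing_loop {a : V × V} (ha : IsMaximalLink f a) {k : V}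
    (hk : IsLoopVertex f k) : NonCrossing arcSupport arcInner (k, k) a := by
  by_cases hka : k ∈ arcSupport a
  · refine Or.inr (Or.inl fun x hx => ?_)
    rw [arcSupport_self k hx]
    refine ⟨hka, ?_, ?_⟩
    · rintro rfl
      rcases hk with hk | ⟨⟨x, hx, hxk⟩, -⟩
      · exact ha.2.1 hk
      · exact ha.2.2.2.1 x hx hxk
    · rintro rfl
      rcases hk with hk | ⟨-, ⟨y, hy, hky⟩⟩
      · obtain ⟨p, hp⟩ := ha.2.2.1
        exact ha.2.1 (hp.killed_iff.2 hk)
      · exact ha.2.2.2.2 y hy hky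
  · refine Or.inl (Set.disjoint_left.2 fun x hx hxa => hka ?_)
    rwa [← Set.mem_singleton_iff.1 (arcSupport_self k hx)]

theorem pairwise_nonCrossing_linkArcs :
    (linkArcs f).Pairwise (NonCrossing arcSupport arcInner) := by
  have hsymm : ∀ a b : V × V, NonCrossing arcSupport arcInner a b →
      NonCrossing arcSupport arcInner b a := by
    rintro a b (H | H | H)
    · exact Or.inl H.symm
    · exact Or.inr (Or.inr H)
    · exact Or.inr (Or.inl H)
  rintro ⟨j, i⟩ (ha | ⟨rfl : j = i, ha⟩) ⟨j', i'⟩ (hb | ⟨rfl : j' = i', hb⟩) hab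
  · exact ha.nonCrossing hb hab
  · exact hsymm _ _ (ha.nonCrossing_loop hb)
  · exact hb.nonCrossing_loop ha
  · refine Or.inl (Set.disjoint_left.2 fun x hx hx' => hab ?_)
    rw [← Set.mem_singleton_iff.1 (arcSupport_self j hx),
      ← Set.mem_singleton_iff.1 (arcSupport_self j' hx')]

theorem exists_path_of_mem_linkArcs (hh : 1 ≤ h) {a : V × V} (ha : a ∈ linkArcs f) :
    ∃ p : Path a.1 a.2, p.length < Fintype.card V ∧ p.length < h := by
  rcases a with ⟨j, i⟩
  rcases ha with ha | ⟨rfl : j = i, -⟩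
  · obtain ⟨p, hp⟩ := ha.2.2.1
    exact ⟨p, hp.length_lt_card ha.2.1, hp.length_lt ha.2.1⟩
  · exact ⟨Path.nil, Fintype.card_pos_iff.2 ⟨j⟩, hh⟩

/-! ### The arcs determine the inverted paths -/

/-- Otherwise links into `k` could be prolonged backwards without end, against the bound on the
length of inverted paths. -/
theorem exists_first_linked {k : V} (hk : f (vertexIdem K h k) ≠ 0) :
    ∃ (x : V) (p : Path x k), Inverts f p ∧ ∀ z, z ≠ x → ¬ Linked f z x := by
  by_contra! H
  have key : ∀ m : ℕ, ∃ (x : V) (p : Path x k), Inverts f p ∧ m ≤ p.length := by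
    intro m
    induction m with
    | zero => exact ⟨k, Path.nil, Inverts.nil k, Nat.zero_le _⟩
    | succ m ih =>
      obtain ⟨x, p, hp, hm⟩ := ih
      obtain ⟨z, hzx, q, hq⟩ := H x p hp
      refine ⟨z, q.comp p, hq.comp hp, ?_⟩
      have : q.length ≠ 0 := fun h0 => hzx (Path.eq_of_length_zero q h0)
      rw [Path.length_comp]
      omega
  obtain ⟨x, p, hp, hm⟩ := key (Fintype.card V)
  exact absurd (hp.length_lt_card (mt hp.killed_iff.1 hk)) (not_lt.2 hm)

theorem exists_last_linked {k : V} (hk : f (vertexIdem K h k) ≠ 0) :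
    ∃ (y : V) (q : Path k y), Inverts f q ∧ ∀ z, z ≠ y → ¬ Linked f y z := by
  by_contra! H
  have key : ∀ m : ℕ, ∃ (y : V) (q : Path k y), Inverts f q ∧ m ≤ q.length := by
    intro m
    induction m with
    | zero => exact ⟨k, Path.nil, Inverts.nil k, Nat.zero_le _⟩
    | succ m ih =>
      obtain ⟨y, q, hq, hm⟩ := ih
      obtain ⟨z, hzy, p, hp⟩ := H y q hq
      refine ⟨z, q.comp p, hq.comp hp, ?_⟩
      have : p.length ≠ 0 := fun h0 => hzy (Path.eq_of_length_zero p h0).symm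
      rw [Path.length_comp]
      omega
  obtain ⟨y, q, hq, hm⟩ := key (Fintype.card V)
  exact absurd (hq.length_lt_card hk) (not_lt.2 hm)

/-- An intermediate vertex of a link lies inside a maximal link. -/
theorem IsLoopVertex.exists_isMaximalLink {k : V} (hk : IsLoopVertex f k)
    (hk0 : f (vertexIdem K h k) ≠ 0) :
    ∃ (a : V × V) (u : Path a.1 k) (v : Path k a.2), IsMaximalLink f a ∧ Inverts f u ∧
      Inverts f v ∧ u.length ≠ 0 ∧ v.length ≠ 0 := by
  obtain ⟨⟨x, hx, hxk⟩, y, hy, hky⟩ := hk.resolve_left hk0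
  obtain ⟨x', u, hu, hx'⟩ := exists_first_linked hk0
  obtain ⟨y', v, hv, hy'⟩ := exists_last_linked hk0
  have hu0 : u.length ≠ 0 := by
    intro h0
    obtain rfl := Path.eq_of_length_zero u h0
    exact hx' x hx hxk
  have hv0 : v.length ≠ 0 := by
    intro h0
    obtain rfl := Path.eq_of_length_zero v h0
    exact hy' y hy hky
  have hx0 : f (vertexIdem K h x') ≠ 0 := mt hu.killed_iff.1 hk0
  refine ⟨(x', y'), u, v, ⟨?_, hx0, ⟨u.comp v, hu.comp hv⟩, hx', hy'⟩, hu, hv, hu0, hv0⟩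
  rintro (rfl : x' = y')
  have := ChainQuiver.length_eq_zero _ ((hu.comp hv).length_lt_card hx0)
  rw [Path.length_comp] at this
  omega

/-- This separates the two meanings of a loop. An inverted path through an annihilated vertex has
annihilated ends, so such a vertex lies on no maximal link; an intermediate term that survives lies
inside one. -/
theorem killed_iff_of_linkArcs (k : V) : f (vertexIdem K h k) = 0 ↔
    (k, k) ∈ linkArcs f ∧ ∀ a ∈ linkArcs f, a.1 ≠ a.2 → k ∉ arcInner a := by
  constructor
  · intro hk
    refine ⟨mem_linkArcs_self.2 (Or.inl hk), fun a ha hne => ?_⟩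
    rw [mem_linkArcs_of_ne hne] at ha
    rintro ⟨⟨u, v, huv⟩, -⟩
    exact ha.2.1 ((ha.inverts_comp huv).killed_of_middle hk)
  · rintro ⟨hk, H⟩
    by_contra hk0
    obtain ⟨a, u, v, ha, hu, hv, hu0, hv0⟩ :=
      (mem_linkArcs_self.1 hk).exists_isMaximalLink hk0
    have hlen := (hu.comp hv).length_lt_card ha.2.1
    rw [Path.length_comp] at hlen
    refine H a (Or.inl ha) ha.1 ⟨⟨u, v, hlen⟩, ?_, ?_⟩
    · rintro rfl
      exact hu0 (ChainQuiver.length_eq_zero u (by omega))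
    · rintro rfl
      exact hv0 (ChainQuiver.length_eq_zero v (by omega))

variable {C : Type u} [Ring C] {g : TruncatedPathAlgebra K V h →+* C}

theorem killed_iff_of_linkArcs_eq (hfg : linkArcs f = linkArcs g) (k : V) :
    f (vertexIdem K h k) = 0 ↔ g (vertexIdem K h k) = 0 := by
  rw [killed_iff_of_linkArcs, killed_iff_of_linkArcs, hfg]

/-- If `k` is an intermediate term for `f`, its loop and its survival carry over to `g`, so `k`
splits some maximal link `b` of `g`. Since `a` and `b` are maximal links of both homomorphisms, the
overlap rule can be applied to either one. -/
theorem inverts_initial_of_linkArcs_eq (hfg : linkArcs f = linkArcs g) {a : V × V}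
    (ha : IsMaximalLink f a) {k : V} {u : Path a.1 k} {v : Path k a.2} (hu : Inverts f u)
    (hv : Inverts f v) : Inverts g u := by
  have hag : IsMaximalLink g a := by
    rwa [← mem_linkArcs_of_ne ha.1, ← hfg, mem_linkArcs_of_ne ha.1]
  have hlen := (hu.comp hv).length_lt_card ha.2.1
  rw [Path.length_comp] at hlen
  by_cases hu0 : u.length = 0
  · rcases a with ⟨j, i⟩
    have h1 : j = k := Path.eq_of_length_zero u hu0
    subst h1
    rw [Path.eq_nil_of_length_zero u hu0]
    exact Inverts.nil _
  by_cases hv0 : v.length = 0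
  · rcases a with ⟨j, i⟩
    have h1 : k = i := Path.eq_of_length_zero v hv0
    subst h1
    have := hag.inverts_comp hlen
    rwa [Path.eq_nil_of_length_zero v hv0, Path.comp_nil] at this
  have hk0 : f (vertexIdem K h k) ≠ 0 := mt hu.killed_iff.2 ha.2.1
  have hk : IsLoopVertex f k := by
    refine Or.inr ⟨⟨a.1, ?_, u, hu⟩, a.2, ?_, v, hv⟩
    · rintro rfl
      exact hu0 (ChainQuiver.length_eq_zero u (by omega))
    · rintro rfl
      exact hv0 (ChainQuiver.length_eq_zero v (by omega))
  have hkg : IsLoopVertex g k := by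
    rwa [← mem_linkArcs_self, ← hfg, mem_linkArcs_self]
  obtain ⟨b, u', v', hb, hu', hv', -⟩ := hkg.exists_isMaximalLink
    (mt (killed_iff_of_linkArcs_eq hfg k).2 hk0)
  have hbf : IsMaximalLink f b := by
    rwa [← mem_linkArcs_of_ne hb.1, hfg, mem_linkArcs_of_ne hb.1]
  have hlen' := (hu'.comp hv').length_lt_card hb.2.1
  rw [Path.length_comp] at hlen'
  rcases Path.eq_comp_or_eq_comp_of_target u u' with ⟨w, rfl⟩ | ⟨w, rfl⟩
  -- Here `b` starts at or before the source of `a`, so `u` is the overlap of two paths inverted by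
  -- `g`.
  · exact (hu'.overlap (hag.inverts_comp hlen)).2.1
  -- Here `b` starts at or after the source of `a`. The overlap rule for `f` links the two sources,
  -- so they agree by maximality, and `u` is the initial piece of `b`.
  · obtain ⟨hw, -⟩ := hu.overlap (hbf.inverts_comp hlen')
    have h1 : a.1 = b.1 := by
      by_contra hne
      exact hbf.2.2.2.1 _ hne ⟨w, hw⟩
    have hw0 : w.length = 0 := by
      rcases a with ⟨j, i⟩
      rcases b with ⟨j', i'⟩
      obtain rfl : j = j' := h1
      rw [Path.length_comp] at hlen
      exact ChainQuiver.length_eq_zero w (by omega)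
    rcases a with ⟨j, i⟩
    rcases b with ⟨j', i'⟩
    obtain rfl : j = j' := h1
    rwa [Path.eq_nil_of_length_zero w hw0, Path.nil_comp]

/-- The arcs determine which paths are inverted. -/
theorem inverts_of_linkArcs_eq (hfg : linkArcs f = linkArcs g) {j i : V} {p : Path j i}
    (hp : Inverts f p) : Inverts g p := by
  by_cases hj : f (vertexIdem K h j) = 0
  · exact Inverts.of_killed p ((killed_iff_of_linkArcs_eq hfg j).1 hj)
      ((killed_iff_of_linkArcs_eq hfg i).1 (hp.killed_iff.1 hj))
  -- Prolonged in both directions, `p` becomes part of a maximal link. It is the difference of the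
  -- two initial pieces `u` and `u.comp p`, so two-out-of-three applies.
  · obtain ⟨x, u, hu, hx⟩ := exists_first_linked hj
    obtain ⟨y, v, hv, hy⟩ := exists_last_linked (mt hp.killed_iff.2 hj)
    have hx0 : f (vertexIdem K h x) ≠ 0 := mt hu.killed_iff.1 hj
    have hup := hu.comp hp
    -- A closed inverted path at a surviving vertex is trivial, and then so is `p`.
    by_cases hxy : x = y
    · subst hxy
      have hlen := ChainQuiver.length_eq_zero _ ((hup.comp hv).length_lt_card hx0)
      rw [Path.length_comp, Path.length_comp] at hlen
      have hp0 : p.length = 0 := by omega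
      obtain rfl := Path.eq_of_length_zero p hp0
      rw [Path.eq_nil_of_length_zero p hp0]
      exact Inverts.nil _
    · have ha : IsMaximalLink f (x, y) := ⟨hxy, hx0, ⟨_, hup.comp hv⟩, hx, hy⟩
      have h1 : Inverts g u :=
        inverts_initial_of_linkArcs_eq (a := (x, y)) hfg ha hu (hp.comp hv)
      have h2 : Inverts g (u.comp p) :=
        inverts_initial_of_linkArcs_eq (a := (x, y)) hfg ha hup hv
      exact h2.of_comp_right h1

end Links

/-! ### Existence of localisations and their comparison -/

section Existence

set_option linter.unusedSectionVars false

variable {K : Type u} [Field K] {V : Type} [Quiver.{0} V] [Fintype V] [DecidableEq V] {h : ℕ}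

local notation "𝔸" => TruncatedPathAlgebra K V h

open Quiver (Path)

/-- Equal arcs mean the same inverted paths and annihilated vertices. Hence each localisation
inverts the maps that define the other, and the universal properties give inverse isomorphisms. -/
theorem UnivLoc.equiv_of_arcs_eq [ChainQuiver V] {L M : UnivLoc (TruncatedPathAlgebra K V h)}
    (hLM : L.arcs = M.arcs) : L ≈ M := by
  rw [L.arcs_eq_linkArcs, M.arcs_eq_linkArcs] at hLM
  obtain ⟨S, hS, hSu⟩ := L.isLocalisation
  obtain ⟨T, hT, hTu⟩ := M.isLocalisation
  have hMS : InvertsAll M.hom S := fun σ hσ =>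
    bijective_map_transfer (fun p => inverts_of_linkArcs_eq hLM)
      (fun k => (killed_iff_of_linkArcs_eq hLM k).1) σ (hS σ hσ)
  have hLT : InvertsAll L.hom T := fun σ hσ =>
    bijective_map_transfer (fun p => inverts_of_linkArcs_eq hLM.symm)
      (fun k => (killed_iff_of_linkArcs_eq hLM k).2) σ (hT σ hσ)
  obtain ⟨φ, hφ, -⟩ := hSu _ M.hom hMS
  obtain ⟨ψ, hψ, -⟩ := hTu _ L.hom hLT
  have h1 : ψ.comp φ = RingHom.id _ := by
    refine (hSu _ L.hom hS).unique ?_ rfl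
    rw [RingHom.comp_assoc, hφ, hψ]
  have h2 : φ.comp ψ = RingHom.id _ := by
    refine (hTu _ M.hom hT).unique ?_ rfl
    rw [RingHom.comp_assoc, hψ, hφ]
  exact ⟨RingEquiv.ofRingHom φ ψ h2 h1, hφ⟩

theorem linkArcs_comp_eq {B C : Type u} [Ring B] [Ring C] (f : 𝔸 →+* B) (e : B ≃+* C) :
    linkArcs (e.toRingHom.comp f) = linkArcs f := by
  have h1 : ∀ {j i : V} (p : Path j i), Inverts (e.toRingHom.comp f) p ↔ Inverts f p := by
    intro j i p
    constructor
    · intro hp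
      have h2 := hp.map e.symm.toRingHom
      have h3 : e.symm.toRingHom.comp (e.toRingHom.comp f) = f := by
        ext
        simp
      rwa [h3] at h2
    · exact fun hp => hp.map _
  have h2 : ∀ k, e.toRingHom.comp f (vertexIdem K h k) = 0 ↔ f (vertexIdem K h k) = 0 := by
    intro k
    simp
  simp only [linkArcs, IsMaximalLink, IsLoopVertex, Linked, h1, h2, ne_eq]

theorem UnivLoc.arcs_eq_of_equiv {L M : UnivLoc (TruncatedPathAlgebra K V h)} (hLM : L ≈ M) :
    L.arcs = M.arcs := by
  obtain ⟨e, he⟩ := hLM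
  rw [L.arcs_eq_linkArcs, M.arcs_eq_linkArcs, ← he, linkArcs_comp_eq]

/-- The source of a path. -/
abbrev AnyPath.source (p : AnyPath V) : V := p.1

/-- The target of a path. -/
abbrev AnyPath.target (p : AnyPath V) : V := p.2.1

/-- The defining relations of the ring obtained from the truncated path algebra by inverting the
paths in `T` and annihilating the vertices in `Z`. -/
inductive InvertRel (T : Set (AnyPath V)) (Z : Set V) :
    FreeAlgebra ℤ (TruncatedPathAlgebra K V h ⊕ T) →
      FreeAlgebra ℤ (TruncatedPathAlgebra K V h ⊕ T) → Prop
  | add (a b) : InvertRel T Z (FreeAlgebra.ι ℤ (Sum.inl (a + b)))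
      (FreeAlgebra.ι ℤ (Sum.inl a) + FreeAlgebra.ι ℤ (Sum.inl b))
  | mul (a b) : InvertRel T Z (FreeAlgebra.ι ℤ (Sum.inl (a * b)))
      (FreeAlgebra.ι ℤ (Sum.inl a) * FreeAlgebra.ι ℤ (Sum.inl b))
  | one : InvertRel T Z (FreeAlgebra.ι ℤ (Sum.inl 1)) 1
  | right (p : T) : InvertRel T Z
      (FreeAlgebra.ι ℤ (Sum.inl (pathClass K h p.1.2.2)) * FreeAlgebra.ι ℤ (Sum.inr p))
      (FreeAlgebra.ι ℤ (Sum.inl (vertexIdem K h p.1.target)))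
  | left (p : T) : InvertRel T Z
      (FreeAlgebra.ι ℤ (Sum.inr p) * FreeAlgebra.ι ℤ (Sum.inl (pathClass K h p.1.2.2)))
      (FreeAlgebra.ι ℤ (Sum.inl (vertexIdem K h p.1.source)))
  -- The two preceding relations leave the part of the new generator outside the corner free; this
  -- one makes the inverse unique. The matching relation at the target follows.
  | corner (p : T) : InvertRel T Z
      (FreeAlgebra.ι ℤ (Sum.inl (vertexIdem K h p.1.source)) * FreeAlgebra.ι ℤ (Sum.inr p))
      (FreeAlgebra.ι ℤ (Sum.inr p))
  | kill (k : Z) : InvertRel T Z (FreeAlgebra.ι ℤ (Sum.inl (vertexIdem K h k.1))) 0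

variable (K h) in
/-- The ring obtained by inverting the paths in `T` and annihilating the vertices in `Z`. -/
abbrev InvertRing (T : Set (AnyPath V)) (Z : Set V) : Type u :=
  RingQuot (InvertRel (K := K) (h := h) T Z)

variable (K h) in
/-- The generators of `InvertRing`. -/
def InvertRing.gen (T : Set (AnyPath V)) (Z : Set V) (x : TruncatedPathAlgebra K V h ⊕ T) :
    InvertRing K h T Z :=
  RingQuot.mkRingHom _ (FreeAlgebra.ι ℤ x)

variable (K h) in
/-- The canonical homomorphism into `InvertRing`. -/
noncomputable def InvertRing.hom (T : Set (AnyPath V)) (Z : Set V) :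
    TruncatedPathAlgebra K V h →+* InvertRing K h T Z :=
  RingHom.mk' ⟨⟨fun a => InvertRing.gen K h T Z (Sum.inl a), by
      rw [InvertRing.gen, RingQuot.mkRingHom_rel InvertRel.one, map_one]⟩, fun a b => by
      simp only [InvertRing.gen]
      rw [RingQuot.mkRingHom_rel (InvertRel.mul a b), map_mul]⟩ fun a b => by
      simp only [MonoidHom.coe_mk, OneHom.coe_mk, InvertRing.gen]
      rw [RingQuot.mkRingHom_rel (InvertRel.add a b), map_add]

variable {T : Set (AnyPath V)} {Z : Set V}

theorem InvertRing.hom_apply (a : 𝔸) :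
    InvertRing.hom K h T Z a = InvertRing.gen K h T Z (Sum.inl a) := rfl

theorem InvertRing.inverts (p : T) : Inverts (InvertRing.hom K h T Z) p.1.2.2 := by
  refine ⟨InvertRing.gen K h T Z (Sum.inr p), ?_, ?_⟩
  · rw [hom_apply, hom_apply, gen, gen, gen, ← map_mul,
      RingQuot.mkRingHom_rel (InvertRel.right p)]
  · rw [hom_apply, hom_apply, gen, gen, gen, ← map_mul,
      RingQuot.mkRingHom_rel (InvertRel.left p)]

theorem InvertRing.kills (k : Z) : InvertRing.hom K h T Z (vertexIdem K h k.1) = 0 := by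
  rw [hom_apply, gen, RingQuot.mkRingHom_rel (InvertRel.kill k), map_zero]

/-- The inverse of a path between the corners of two idempotents is unique, so the values on the
algebra force those on the added inverses. -/
theorem InvertRing.hom_ext {C : Type u} [Ring C] {φ ψ : InvertRing K h T Z →+* C}
    (H : φ.comp (InvertRing.hom K h T Z) = ψ.comp (InvertRing.hom K h T Z)) : φ = ψ := by
  have hA : ∀ a, φ (InvertRing.hom K h T Z a) = ψ (InvertRing.hom K h T Z a) :=
    fun a => congrArg (fun χ => χ a) H
  apply RingQuot.ringQuot_ext
  have key : (φ.comp (RingQuot.mkRingHom (InvertRel (K := K) (h := h) T Z))).toIntAlgHom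
      = (ψ.comp (RingQuot.mkRingHom (InvertRel (K := K) (h := h) T Z))).toIntAlgHom := by
    apply FreeAlgebra.hom_ext
    funext x
    rcases x with a | p
    · exact hA a
    · change φ (gen K h T Z (Sum.inr p)) = ψ (gen K h T Z (Sum.inr p))
      set y := gen K h T Z (Sum.inr p) with hy
      have h1 : hom K h T Z (pathClass K h p.1.2.2) * y
          = hom K h T Z (vertexIdem K h p.1.target) := by
        rw [hom_apply, hom_apply, hy, gen, gen, gen, ← map_mul,
          RingQuot.mkRingHom_rel (InvertRel.right p)]
      have h2 : y * hom K h T Z (pathClass K h p.1.2.2)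
          = hom K h T Z (vertexIdem K h p.1.source) := by
        rw [hom_apply, hom_apply, hy, gen, gen, gen, ← map_mul,
          RingQuot.mkRingHom_rel (InvertRel.left p)]
      have h3 : hom K h T Z (vertexIdem K h p.1.source) * y = y := by
        rw [hom_apply, hy, gen, gen, ← map_mul, RingQuot.mkRingHom_rel (InvertRel.corner p)]
      have h4 : y * hom K h T Z (vertexIdem K h p.1.target) = y := by
        rw [← h1, ← mul_assoc, h2, h3]
      calc φ y = φ (hom K h T Z (vertexIdem K h p.1.source)) * φ y := by rw [← map_mul, h3]
        _ = ψ y * (ψ (hom K h T Z (pathClass K h p.1.2.2)) * φ y) := by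
          rw [hA, ← h2, map_mul, mul_assoc]
        _ = ψ y * φ (hom K h T Z (vertexIdem K h p.1.target)) := by
          rw [← hA, ← map_mul, h1]
        _ = ψ y := by rw [hA, ← map_mul, h4]
  exact RingHom.ext fun x => congrArg (fun χ => χ x) key

theorem InvertRing.exists_factor {C : Type u} [Ring C] (g : 𝔸 →+* C)
    (hT : ∀ p ∈ T, Inverts g p.2.2) (hZ : ∀ k ∈ Z, g (vertexIdem K h k) = 0) :
    ∃ φ : InvertRing K h T Z →+* C, φ.comp (InvertRing.hom K h T Z) = g := by
  choose! b hb hb' using hT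
  -- The inverse `b p` need not lie in the corner, so it is first multiplied by the idempotent of
  -- the source.
  let F : FreeAlgebra ℤ (TruncatedPathAlgebra K V h ⊕ T) →ₐ[ℤ] C :=
    FreeAlgebra.lift ℤ (Sum.elim g fun p => g (vertexIdem K h p.1.source) * b p.1)
  have hF : ∀ a, F (FreeAlgebra.ι ℤ (Sum.inl a)) = g a := by
    intro a
    simp [F]
  have hF' : ∀ p : T, F (FreeAlgebra.ι ℤ (Sum.inr p))
      = g (vertexIdem K h p.1.source) * b p.1 := by
    intro p
    simp [F]
  have hrel : ∀ ⦃x y⦄, InvertRel (K := K) (h := h) T Z x y → F.toRingHom x = F.toRingHom y := by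
    intro x y hxy
    change F x = F y
    cases hxy with
    | add a b => simp only [map_add, hF]
    | mul a b => simp only [map_mul, hF]
    | one => rw [hF, map_one, map_one]
    | right p =>
      rw [map_mul, hF, hF, hF', ← mul_assoc, Inverts.map_mul_idem, hb _ p.2]
    | left p =>
      rw [map_mul, hF, hF, hF', mul_assoc, hb' _ p.2, ← map_mul, vertexIdem_mul_self]
    | corner p =>
      rw [map_mul, hF, hF', ← mul_assoc, ← map_mul, vertexIdem_mul_self]
    | kill k => rw [hF, map_zero, hZ _ k.2]
  refine ⟨RingQuot.lift ⟨F.toRingHom, hrel⟩, RingHom.ext fun a => ?_⟩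
  rw [RingHom.comp_apply, hom_apply, gen, RingQuot.lift_mkRingHom_apply]
  exact hF a

/-- There is a universal localisation that inverts the paths in `T` and annihilates the vertices
in `Z`, and it is initial with this property. -/
theorem exists_univLoc (T : Set (AnyPath V)) (Z : Set V) :
    ∃ L : UnivLoc 𝔸, (∀ p ∈ T, Inverts L.hom p.2.2) ∧
      (∀ k ∈ Z, L.hom (vertexIdem K h k) = 0) ∧
      ∀ (C : Type u) [Ring C] (g : 𝔸 →+* C), (∀ p ∈ T, Inverts g p.2.2) →
        (∀ k ∈ Z, g (vertexIdem K h k) = 0) → ∃ φ : L.carrier →+* C, φ.comp L.hom = g := by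
  let σ (p : AnyPath V) : ProjMap 𝔸 :=
    { P := vertexProj K h p.2.1, Q := vertexProj K h p.1, hom := pathMap K h p.2.2 }
  let τ (k : V) : ProjMap 𝔸 := { P := vertexProj K h k, Q := vertexProj K h k, hom := 0 }
  have hS : ∀ {C : Type u} [Ring C] (g : 𝔸 →+* C), InvertsAll g (σ '' T ∪ τ '' Z) ↔
      (∀ p ∈ T, Inverts g p.2.2) ∧ ∀ k ∈ Z, g (vertexIdem K h k) = 0 := by
    intro C _ g
    constructor
    · intro H
      exact ⟨fun p hp => (bijective_map_pathMap_iff g p.2.2).1 (H _ (Or.inl ⟨p, hp, rfl⟩)),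
        fun k hk => (bijective_map_zero_iff g k).1 (H _ (Or.inr ⟨k, hk, rfl⟩))⟩
    · rintro ⟨H₁, H₂⟩ _ (⟨p, hp, rfl⟩ | ⟨k, hk, rfl⟩)
      · exact (bijective_map_pathMap_iff g p.2.2).2 (H₁ p hp)
      · exact (bijective_map_zero_iff g k).2 (H₂ k hk)
  have hT : ∀ p ∈ T, Inverts (InvertRing.hom K h T Z) p.2.2 := fun p hp =>
    InvertRing.inverts ⟨p, hp⟩
  have hZ : ∀ k ∈ Z, InvertRing.hom K h T Z (vertexIdem K h k) = 0 := fun k hk =>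
    InvertRing.kills ⟨k, hk⟩
  refine ⟨⟨InvertRing K h T Z, InvertRing.hom K h T Z, σ '' T ∪ τ '' Z, (hS _).2 ⟨hT, hZ⟩, ?_⟩,
    hT, hZ, fun C _ g h1 h2 => InvertRing.exists_factor g h1 h2⟩
  intro C _ g hg
  obtain ⟨h1, h2⟩ := (hS g).1 hg
  obtain ⟨φ, hφ⟩ := InvertRing.exists_factor g h1 h2
  exact ⟨φ, hφ, fun ψ hψ => InvertRing.hom_ext (hψ.trans hφ.symm)⟩

end Existence

/-! ### The representation supported on an arc -/

section Segments

set_option linter.unusedSectionVars false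

variable {K : Type u} [Field K] {V : Type} [Quiver.{0} V] [Fintype V] [DecidableEq V] {h : ℕ}

open Quiver (Path)

/-- The path `p` is a piece of the arc `a`. -/
def Inside (a : V × V) {x y : V} (p : Path x y) : Prop :=
  ∃ (u : Path a.1 x) (v : Path y a.2), u.length + p.length + v.length < Fintype.card V

namespace Inside

variable {a : V × V} {x y z : V}

theorem source_mem {p : Path x y} (hp : Inside a p) : x ∈ arcSupport a := by
  obtain ⟨u, v, huv⟩ := hp
  exact ⟨u, p.comp v, by rw [Path.length_comp]; omega⟩

theorem target_mem {p : Path x y} (hp : Inside a p) : y ∈ arcSupport a := by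
  obtain ⟨u, v, huv⟩ := hp
  exact ⟨u.comp p, v, by rw [Path.length_comp]; omega⟩

theorem nil_iff : Inside a (Path.nil : Path x x) ↔ x ∈ arcSupport a :=
  ⟨source_mem, fun ⟨u, v, huv⟩ => ⟨u, v, by rw [Path.length_nil]; omega⟩⟩

theorem of_comp_left {p : Path x y} {q : Path y z} (H : Inside a (p.comp q)) : Inside a p := by
  obtain ⟨u, v, huv⟩ := H
  rw [Path.length_comp] at huv
  exact ⟨u, q.comp v, by rw [Path.length_comp]; omega⟩

theorem of_comp_right {p : Path x y} {q : Path y z} (H : Inside a (p.comp q)) : Inside a q := by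
  obtain ⟨u, v, huv⟩ := H
  rw [Path.length_comp] at huv
  exact ⟨u.comp p, v, by rw [Path.length_comp]; omega⟩

variable [ChainQuiver V]

/-- The initial segments of the arc up to `y` given by the two hypotheses agree, being short paths
with the same end points, so the pieces fit together without an extra turn around a cycle. -/
theorem comp {p : Path x y} {q : Path y z} (hp : Inside a p) (hq : Inside a q) :
    Inside a (p.comp q) := by
  obtain ⟨u, v, huv⟩ := hp
  obtain ⟨u', v', huv'⟩ := hq
  have : u.comp p = u' := Path.eq_of_length_lt_card (by rw [Path.length_comp]; omega) (by omega)
  have hlen := congrArg Path.length this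
  rw [Path.length_comp] at hlen
  exact ⟨u, v', by rw [Path.length_comp]; omega⟩

theorem length_le {p : Path x y} (hp : Inside a p) {q : Path a.1 a.2}
    (hq : q.length < Fintype.card V) : p.length ≤ q.length := by
  obtain ⟨u, v, huv⟩ := hp
  have : (u.comp p).comp v = q :=
    Path.eq_of_length_lt_card (by rw [Path.length_comp, Path.length_comp]; omega) hq
  rw [← this, Path.length_comp, Path.length_comp]
  omega

theorem eq_source {p : Path x a.1} (hp : Inside a p) : x = a.1 := by
  obtain ⟨u, v, huv⟩ := hp
  have := ChainQuiver.length_eq_zero (u.comp p) (by rw [Path.length_comp]; omega)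
  rw [Path.length_comp] at this
  exact Path.eq_of_length_zero p (by omega)

theorem eq_target {p : Path a.2 y} (hp : Inside a p) : y = a.2 := by
  obtain ⟨u, v, huv⟩ := hp
  have := ChainQuiver.length_eq_zero (p.comp v) (by rw [Path.length_comp]; omega)
  rw [Path.length_comp] at this
  exact (Path.eq_of_length_zero p (by omega)).symm

/-- Starting on `a`, the path `t` either stays on `a` or reaches its end point; in the latter case
that end point would lie on `b`, hence in the interior of `a`. -/
theorem of_support_subset_inner {b : V × V} (hba : arcSupport b ⊆ arcInner a) {t : Path b.1 b.2}
    (ht : t.length < Fintype.card V) : Inside a t := by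
  obtain ⟨⟨u, v, huv⟩, -⟩ := hba (show b.1 ∈ arcSupport b from ⟨Path.nil, t, by simpa using ht⟩)
  rcases Path.eq_comp_or_eq_comp_of_source t v with ⟨r, rfl⟩ | ⟨r, rfl⟩
  · rw [Path.length_comp] at huv
    exact ⟨u, r, by omega⟩
  · rw [Path.length_comp] at ht
    exact absurd rfl (hba (show a.2 ∈ arcSupport b from ⟨v, r, ht⟩)).2.2

end Inside

noncomputable instance (a : V × V) : Fintype (arcSupport a) := Fintype.ofFinite _

open Classical in
variable (K) in
/-- The matrix by which the path `p` acts on the representation supported on the arc `a`. -/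
noncomputable def segmentMatrix (a : V × V) {x y : V} (p : Path x y) :
    Matrix (arcSupport a) (arcSupport a) K :=
  if H : Inside a p then Matrix.single ⟨y, H.target_mem⟩ ⟨x, H.source_mem⟩ 1 else 0

variable [ChainQuiver V]

/-- The action of the truncated path algebra on the representation supported on an arc. -/
noncomputable def segmentHom (a : V × V)
    (ha : ∃ q : Path a.1 a.2, q.length < Fintype.card V ∧ q.length < h) :
    TruncatedPathAlgebra K V h →+* Matrix (arcSupport a) (arcSupport a) K :=
  liftPaths (segmentMatrix K a)
    (by
      intro x y z p q
      by_cases H : Inside a (q.comp p)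
      · rw [segmentMatrix, segmentMatrix, segmentMatrix, dif_pos H, dif_pos H.of_comp_left,
          dif_pos H.of_comp_right, Matrix.single_mul_single_same, one_mul]
      · rw [segmentMatrix.eq_def K a (q.comp p), dif_neg H]
        by_cases hp : Inside a p
        -- Pieces along the arc compose to a piece along the arc, so a composite that leaves the arc
        -- has a factor acting by zero.
        · have hq : ¬ Inside a q := fun hq => H (hq.comp hp)
          rw [segmentMatrix.eq_def K a q, dif_neg hq, mul_zero]
        · rw [segmentMatrix, dif_neg hp, zero_mul])
    (by
      intro x y z w p q hne
      rw [segmentMatrix, segmentMatrix]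
      split_ifs
      · rw [Matrix.single_mul_single_of_ne]
        exact fun H => hne (congrArg Subtype.val H)
      all_goals simp)
    (by
      ext s t
      rw [Matrix.sum_apply, Finset.sum_eq_single s.1]
      · rw [segmentMatrix, dif_pos (Inside.nil_iff.2 s.2)]
        simp [Matrix.one_apply, Matrix.single_apply]
      · intro v _ hv
        rw [segmentMatrix]
        split_ifs
        · rw [Matrix.single_apply, if_neg]
          rintro ⟨rfl, -⟩
          exact hv rfl
        · rfl
      · intro hs
        exact absurd (Finset.mem_univ _) hs)
    (by
      intro x y p hp
      rw [segmentMatrix, dif_neg]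
      intro H
      obtain ⟨q, hq, hqh⟩ := ha
      have := H.length_le hq
      omega)

variable {a : V × V} (ha : ∃ q : Path a.1 a.2, q.length < Fintype.card V ∧ q.length < h)

theorem segmentHom_pathClass {x y : V} (p : Path x y) :
    segmentHom a ha (pathClass K h p) = segmentMatrix K a p :=
  liftPaths_pathClass _ _ _ _ _ p

theorem segmentHom_vertexIdem_eq_zero_iff (k : V) :
    segmentHom a ha (vertexIdem K h k) = 0 ↔ k ∉ arcSupport a := by
  rw [vertexIdem, segmentHom_pathClass, segmentMatrix, ← Inside.nil_iff]
  split_ifs with H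
  · refine ⟨fun h0 => ?_, fun h0 => absurd H h0⟩
    have := congrFun (congrFun h0 ⟨k, H.target_mem⟩) ⟨k, H.target_mem⟩
    simp at this
  · exact ⟨fun _ => H, fun _ => rfl⟩

/-- A path along the arc acts by a matrix unit, inverted by its transpose. Any other path acts by
zero, which is invertible only between zero spaces. -/
theorem inverts_segmentHom_iff {x y : V} (p : Path x y) :
    Inverts (segmentHom (K := K) a ha) p ↔
      Inside a p ∨ (x ∉ arcSupport a ∧ y ∉ arcSupport a) := by
  constructor
  · intro H
    by_cases hp : Inside a p
    · exact Or.inl hp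
    · right
      obtain ⟨b, hb, hb'⟩ := H
      rw [segmentHom_pathClass, segmentMatrix, dif_neg hp] at hb hb'
      rw [zero_mul] at hb
      rw [mul_zero] at hb'
      exact ⟨(segmentHom_vertexIdem_eq_zero_iff ha x).1 hb'.symm,
        (segmentHom_vertexIdem_eq_zero_iff ha y).1 hb.symm⟩
  · rintro (hp | ⟨hx, hy⟩)
    · refine ⟨Matrix.single ⟨x, hp.source_mem⟩ ⟨y, hp.target_mem⟩ 1, ?_, ?_⟩
      · rw [vertexIdem, segmentHom_pathClass, segmentHom_pathClass, segmentMatrix, segmentMatrix,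
          dif_pos hp, dif_pos (Inside.nil_iff.2 hp.target_mem), Matrix.single_mul_single_same,
          one_mul]
      · rw [vertexIdem, segmentHom_pathClass, segmentHom_pathClass, segmentMatrix, segmentMatrix,
          dif_pos hp, dif_pos (Inside.nil_iff.2 hp.source_mem), Matrix.single_mul_single_same,
          one_mul]
    · exact Inverts.of_killed p ((segmentHom_vertexIdem_eq_zero_iff ha x).2 hx)
        ((segmentHom_vertexIdem_eq_zero_iff ha y).2 hy)

/-- The localisation at all paths that act invertibly on the representations supported on the arcs
in `D`. -/
theorem exists_univLoc_of_arcs (D : Set (V × V))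
    (hD : ∀ a ∈ D, ∃ q : Path a.1 a.2, q.length < Fintype.card V ∧ q.length < h) :
    ∃ L : UnivLoc (TruncatedPathAlgebra K V h),
      (∀ {x y : V} (p : Path x y), Inverts L.hom p ↔
        ∀ a ∈ D, Inside a p ∨ (x ∉ arcSupport a ∧ y ∉ arcSupport a)) ∧
      ∀ k, L.hom (vertexIdem K h k) = 0 ↔ ∀ a ∈ D, k ∉ arcSupport a := by
  obtain ⟨L, hT, hZ, hL⟩ := exists_univLoc (K := K) (h := h)
    {p : AnyPath V | ∀ a ∈ D, Inside a p.2.2 ∨ (p.1 ∉ arcSupport a ∧ p.2.1 ∉ arcSupport a)}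
    {k : V | ∀ a ∈ D, k ∉ arcSupport a}
  -- Each segment representation factors through the localisation, so the localisation cannot invert
  -- a path or annihilate a vertex unless all these representations do.
  have hfac : ∀ a (ha : a ∈ D), ∃ φ : L.carrier →+* Matrix (arcSupport a) (arcSupport a) K,
      φ.comp L.hom = segmentHom a (hD a ha) := by
    intro a ha
    refine hL _ _ (fun p hp => ?_) fun k hk => ?_
    · exact (inverts_segmentHom_iff (hD a ha) _).2 (hp a ha)
    · exact (segmentHom_vertexIdem_eq_zero_iff (hD a ha) _).2 (hk a ha)
  refine ⟨L, fun {x y} p => ⟨fun hp a ha => ?_, fun hp => hT ⟨x, y, p⟩ hp⟩,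
    fun k => ⟨fun hk a ha => ?_, fun hk => hZ k hk⟩⟩
  · obtain ⟨φ, hφ⟩ := hfac a ha
    rw [← inverts_segmentHom_iff (K := K) (hD a ha), ← hφ]
    exact hp.map φ
  · obtain ⟨φ, hφ⟩ := hfac a ha
    rw [← segmentHom_vertexIdem_eq_zero_iff (K := K) (hD a ha), ← hφ, RingHom.comp_apply, hk,
      map_zero]

/-! ### Every configuration comes from a localisation -/

/-- The arcs of a configuration that are not loops, together with the vertices that are neither
loops nor end points of other arcs. -/
def testArcs (C : Set (V × V)) : Set (V × V) :=
  {a | a ∈ C ∧ a.1 ≠ a.2} ∪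
  {a | a.1 = a.2 ∧ a ∉ C ∧ ∀ b ∈ C, b.1 ≠ b.2 → a.1 ≠ b.1 ∧ a.1 ≠ b.2}

/-- A one-point test arc avoids the end points of the arcs of `C`, so it is off such an arc or
strictly inside it. -/
theorem nonCrossing_testArcs {C : Set (V × V)}
    (hC : C.Pairwise (NonCrossing arcSupport arcInner)) {a b : V × V} (ha : a ∈ C)
    (hne : a.1 ≠ a.2) (hb : b ∈ testArcs C) (hab : a ≠ b) :
    NonCrossing arcSupport arcInner a b := by
  rcases b with ⟨k, k'⟩
  rcases hb with ⟨hb, -⟩ | ⟨rfl : k = k', -, hk⟩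
  · exact hC ha hb hab
  · by_cases hka : k ∈ arcSupport a
    · refine Or.inr (Or.inr fun x hx => ?_)
      rw [arcSupport_self k hx]
      exact ⟨hka, hk a ha hne⟩
    · refine Or.inl (Set.disjoint_right.2 fun x hx hxa => hka ?_)
      rwa [← Set.mem_singleton_iff.1 (arcSupport_self k hx)]

/-- The localisation for the test arcs works: a link that meets a test arc is a piece of it, so it
can neither enter its source nor leave its target nontrivially. The one-point test arcs thus isolate
vertices that must carry no arc, while a vertex on no test arc is annihilated and so becomes a loop.
-/
theorem exists_univLoc_linkArcs_eq (hh : 1 ≤ h) (C : Set (V × V))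
    (hlen : ∀ a ∈ C, ∃ q : Path a.1 a.2, q.length < Fintype.card V ∧ q.length < h)
    (hC : C.Pairwise (NonCrossing arcSupport arcInner)) :
    ∃ L : UnivLoc (TruncatedPathAlgebra K V h), linkArcs L.hom = C := by
  have hD : ∀ a ∈ testArcs C, ∃ q : Path a.1 a.2, q.length < Fintype.card V ∧ q.length < h := by
    rintro ⟨j, i⟩ (⟨ha, -⟩ | ⟨rfl : j = i, -⟩)
    · exact hlen _ ha
    · exact ⟨Path.nil, Fintype.card_pos_iff.2 ⟨j⟩, hh⟩
  obtain ⟨L, hI, hZ⟩ := exists_univLoc_of_arcs (K := K) (h := h) (testArcs C) hD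
  have hsource : ∀ a ∈ testArcs C, a.1 ∈ arcSupport a := by
    intro a ha
    obtain ⟨q, hq, -⟩ := hD a ha
    exact ⟨Path.nil, q, by simpa using hq⟩
  have htarget : ∀ a ∈ testArcs C, a.2 ∈ arcSupport a := by
    intro a ha
    obtain ⟨q, hq, -⟩ := hD a ha
    exact ⟨q, Path.nil, by simpa using hq⟩
  -- a link that meets an arc is a piece of it
  have hin : ∀ a ∈ testArcs C, ∀ {x y : V} {p : Path x y}, Inverts L.hom p →
      (x ∈ arcSupport a ∨ y ∈ arcSupport a) → Inside a p := by
    intro a ha x y p hp hxy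
    rcases (hI p).1 hp a ha with H | ⟨H, H'⟩
    · exact H
    · exact absurd hxy (by tauto)
  have hfirst : ∀ a ∈ testArcs C, ∀ x, x ≠ a.1 → ¬ Linked L.hom x a.1 := by
    rintro a ha x hx ⟨p, hp⟩
    exact hx (hin a ha hp (Or.inr (hsource a ha))).eq_source
  have hlast : ∀ a ∈ testArcs C, ∀ y, y ≠ a.2 → ¬ Linked L.hom a.2 y := by
    rintro a ha y hy ⟨p, hp⟩
    exact hy (hin a ha hp (Or.inl (htarget a ha))).eq_target
  have hmax : ∀ a ∈ C, a.1 ≠ a.2 → IsMaximalLink L.hom a := by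
    intro a ha hne
    have haD : a ∈ testArcs C := Or.inl ⟨ha, hne⟩
    obtain ⟨q, hq, -⟩ := hlen a ha
    refine ⟨hne, fun h0 => (hZ _).1 h0 a haD (hsource a haD), ⟨q, (hI q).2 fun b hb => ?_⟩,
      hfirst a haD, hlast a haD⟩
    by_cases hab : a = b
    · subst hab
      exact Or.inl ⟨Path.nil, Path.nil, by simpa using hq⟩
    · rcases nonCrossing_testArcs hC ha hne hb hab with H | H | H
      · exact Or.inr ⟨Set.disjoint_left.1 H (hsource a haD),
          Set.disjoint_left.1 H (htarget a haD)⟩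
      · exact Or.inl (Inside.of_support_subset_inner H hq)
      · exact Or.inr ⟨fun H' => (H H').2.1 rfl, fun H' => (H H').2.2 rfl⟩
  have hloop : ∀ k, (k, k) ∈ C → IsLoopVertex L.hom k := by
    intro k hk
    by_cases hk0 : L.hom (vertexIdem K h k) = 0
    · exact Or.inl hk0
    · right
      -- The smallest test arc around a surviving loop vertex `k` will be the link that has `k` as
      -- an intermediate term.
      have hex : ∃ m, ∃ a ∈ testArcs C, k ∈ arcSupport a ∧ (arcSupport a).ncard = m := by
        rw [hZ] at hk0
        push Not at hk0
        obtain ⟨a, ha, hka⟩ := hk0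
        exact ⟨_, a, ha, hka, rfl⟩
      classical
      obtain ⟨a, ha, hka, hcard⟩ := Nat.find_spec hex
      have hmin : ∀ b ∈ testArcs C, k ∈ arcSupport b →
          (arcSupport a).ncard ≤ (arcSupport b).ncard := by
        intro b hb hkb
        rw [hcard]
        exact Nat.find_min' hex ⟨b, hb, hkb, rfl⟩
      rcases a with ⟨j, i⟩
      rcases id ha with ⟨haC, hne⟩ | ⟨rfl : j = i, haC, -⟩
      swap
      · rw [← Set.mem_singleton_iff.1 (arcSupport_self j hka)] at haC
        exact absurd hk haC
      have hkk : (k, k) ≠ (j, i) := by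
        intro H
        obtain ⟨rfl, rfl⟩ := Prod.mk.inj H
        exact hne rfl
      have hkin : k ≠ j ∧ k ≠ i := by
        have hkself : k ∈ arcSupport (k, k) :=
          ⟨Path.nil, Path.nil, Fintype.card_pos_iff.2 ⟨k⟩⟩
        rcases hC hk haC hkk with H | H | H
        · exact absurd hka (Set.disjoint_left.1 H hkself)
        · exact (H hkself).2
        · exact absurd rfl (H hka).2.1
      obtain ⟨u, v, huv⟩ := id hka
      -- By minimality, no test arc nested inside `(j, i)` contains `k`. So every test arc contains
      -- the whole of `(j, i)` or misses `j`, `k` and `i`, and both halves of the link are inverted.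
      have hpiece : ∀ b ∈ testArcs C, Inside b (u.comp v) ∨
          (j ∉ arcSupport b ∧ k ∉ arcSupport b ∧ i ∉ arcSupport b) := by
        intro b hb
        by_cases hab : (j, i) = b
        · subst hab
          exact Or.inl ⟨Path.nil, Path.nil, by simpa using huv⟩
        · rcases nonCrossing_testArcs hC haC hne hb hab with H | H | H
          · exact Or.inr ⟨Set.disjoint_left.1 H (hsource _ ha), Set.disjoint_left.1 H hka,
              Set.disjoint_left.1 H (htarget _ ha)⟩
          · exact Or.inl (Inside.of_support_subset_inner H (by simpa using huv))
          · refine Or.inr ⟨fun H' => (H H').2.1 rfl, fun hkb => ?_, fun H' => (H H').2.2 rfl⟩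
            refine absurd (hmin b hb hkb) (not_le.2 (Set.ncard_lt_ncard ?_ (Set.toFinite _)))
            refine ⟨fun x hx => (H hx).1, fun H' => ?_⟩
            exact (H (H' (hsource _ ha))).2.1 rfl
      refine ⟨⟨j, hkin.1.symm, u, (hI u).2 fun b hb => ?_⟩, i, hkin.2.symm, v,
        (hI v).2 fun b hb => ?_⟩
      · exact (hpiece b hb).imp Inside.of_comp_left fun H => ⟨H.1, H.2.1⟩
      · exact (hpiece b hb).imp Inside.of_comp_right fun H => ⟨H.2.1, H.2.2⟩
  -- a vertex that is not a loop is an end point of a test arc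
  have hend : ∀ k, (k, k) ∉ C → (k, k) ∈ testArcs C ∨
      ∃ a ∈ C, a.1 ≠ a.2 ∧ (k = a.1 ∨ k = a.2) := by
    intro k hk
    by_contra! H
    refine H.1 (Or.inr ⟨rfl, hk, fun b hb hne => ?_⟩)
    exact H.2 b hb hne
  refine ⟨L, Set.Subset.antisymm ?_ ?_⟩
  · rintro ⟨j, i⟩ (ha | ⟨rfl : j = i, hk⟩)
    -- The source of a maximal link is not a loop, and a nontrivial link can start neither at a
    -- one-point test arc nor at the target of an arc of `C`.
    · have hj : ∃ a ∈ C, a.1 ≠ a.2 ∧ j = a.1 := by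
        have hjC : (j, j) ∉ C := fun hj => by
          obtain ⟨⟨x, hx, hxj⟩, -⟩ := (hloop j hj).resolve_left ha.2.1
          exact ha.2.2.2.1 x hx hxj
        rcases hend j hjC with H | ⟨a, haC, hne, rfl | rfl⟩
        · exact absurd ha.2.2.1 (hlast _ H i ha.1.symm)
        · exact ⟨a, haC, hne, rfl⟩
        · exact absurd (hmax a haC hne).2.2.1 (ha.2.2.2.1 _ hne)
      have hi : ∃ a ∈ C, a.1 ≠ a.2 ∧ i = a.2 := by
        have hi0 : L.hom (vertexIdem K h i) ≠ 0 := by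
          obtain ⟨p, hp⟩ := ha.2.2.1
          exact mt hp.killed_iff.2 ha.2.1
        have hiC : (i, i) ∉ C := fun hi => by
          obtain ⟨-, y, hy, hiy⟩ := (hloop i hi).resolve_left hi0
          exact ha.2.2.2.2 y hy hiy
        rcases hend i hiC with H | ⟨a, haC, hne, rfl | rfl⟩
        · exact absurd ha.2.2.1 (hfirst _ H j ha.1)
        · exact absurd (hmax a haC hne).2.2.1 (ha.2.2.2.2 _ hne.symm)
        · exact ⟨a, haC, hne, rfl⟩
      obtain ⟨⟨_, y⟩, haC, hne, rfl⟩ := hj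
      obtain ⟨⟨x, _⟩, hbC, hne', rfl⟩ := hi
      by_cases hab : (j, y) = (x, i)
      · obtain ⟨rfl, rfl⟩ := Prod.mk.inj hab
        exact haC
      · have haD : (j, y) ∈ testArcs C := Or.inl ⟨haC, hne⟩
        have hbD : (x, i) ∈ testArcs C := Or.inl ⟨hbC, hne'⟩
        obtain ⟨p, hp⟩ := ha.2.2.1
        have h1 := hin _ haD hp (Or.inl (hsource _ haD))
        have h2 := hin _ hbD hp (Or.inr (htarget _ hbD))
        -- The link from `j` to `i` is a piece of both arcs, one starting at `j` and the other
        -- ending at `i`. Different arcs of this kind would cross.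
        rcases hC haC hbC hab with H | H | H
        · exact absurd h2.source_mem (Set.disjoint_left.1 H h1.source_mem)
        · exact absurd rfl (H h1.target_mem).2.2
        · exact absurd rfl (H h2.source_mem).2.1
    · by_contra hkC
      have hbad : ∀ k, IsLoopVertex L.hom k → (k, k) ∉ C → False := by
        intro k hk hkC
        rcases hend k hkC with H | ⟨a, haC, hne, rfl | rfl⟩
        · rcases hk with hk | ⟨⟨x, hx, hxk⟩, -⟩
          · exact (hZ k).1 hk _ H (hsource _ H)
          · exact hfirst _ H x hx hxk
        · rcases hk with hk | ⟨⟨x, hx, hxk⟩, -⟩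
          · exact (hmax a haC hne).2.1 hk
          · exact (hmax a haC hne).2.2.2.1 x hx hxk
        · rcases hk with hk | ⟨-, y, hy, hky⟩
          · exact (hZ _).1 hk a (Or.inl ⟨haC, hne⟩) (htarget a (Or.inl ⟨haC, hne⟩))
          · exact (hmax a haC hne).2.2.2.2 y hy hky
      exact hbad j hk hkC
  · rintro ⟨j, i⟩ ha
    by_cases hji : j = i
    · subst hji
      exact Or.inr ⟨rfl, hloop j ha⟩
    · exact Or.inl (hmax _ ha hji)

end Segments

/-! ### The bijection for an arbitrary chain quiver -/

section Bijection

variable {K : Type u} [Field K] {V : Type} [Quiver.{0} V] [Fintype V] [DecidableEq V]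
  [ChainQuiver V] {h : ℕ}

open Quiver (Path)

/-- The epiclasses of universal localisations correspond to the configurations of non-crossing
arcs, for any type of configurations that consists of these sets of arcs. -/
theorem exists_equiv_config (hh : 1 ≤ h) {Γ : Type} (arcs : Γ → Set (V × V))
    (hinj : Function.Injective arcs)
    (hrange : ∀ C, C ∈ Set.range arcs ↔
      (∀ a ∈ C, ∃ q : Path a.1 a.2, q.length < Fintype.card V ∧ q.length < h) ∧
        C.Pairwise (NonCrossing arcSupport arcInner)) :
    ∃ e : Uniloc (TruncatedPathAlgebra K V h) ≃ Γ,
      ∀ L : UnivLoc (TruncatedPathAlgebra K V h), arcs (e L.epiclass) = L.arcs := by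
  have hL : ∀ L : UnivLoc (TruncatedPathAlgebra K V h), ∃ c, arcs c = L.arcs := by
    intro L
    refine (hrange _).2 ?_
    rw [L.arcs_eq_linkArcs]
    exact ⟨fun a ha => exists_path_of_mem_linkArcs hh ha, pairwise_nonCrossing_linkArcs⟩
  choose F hF using hL
  let G : Uniloc (TruncatedPathAlgebra K V h) → Γ := Quotient.lift F fun L M hLM => by
    apply hinj
    rw [hF, hF, UnivLoc.arcs_eq_of_equiv hLM]
  have hG : ∀ L : UnivLoc (TruncatedPathAlgebra K V h), G L.epiclass = F L := fun L => rfl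
  have hbij : Function.Bijective G := by
    constructor
    · intro x y
      induction x using Quotient.inductionOn with | _ L => ?_
      induction y using Quotient.inductionOn with | _ M => ?_
      intro hLM
      apply Quotient.sound
      apply UnivLoc.equiv_of_arcs_eq
      rw [← hF, ← hF]
      exact congrArg arcs hLM
    · intro c
      obtain ⟨h1, h2⟩ := (hrange (arcs c)).1 ⟨c, rfl⟩
      obtain ⟨L, hLc⟩ := exists_univLoc_linkArcs_eq (K := K) hh _ h1 h2
      refine ⟨L.epiclass, hinj ?_⟩
      rw [hG, hF, L.arcs_eq_linkArcs, hLc]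
  refine ⟨Equiv.ofBijective G hbij, fun L => ?_⟩
  rw [Equiv.ofBijective_apply, hG, hF]

end Bijection

/-! ### The linear quiver -/

namespace LineVertex

variable {n : ℕ}

open Quiver (Path)

theorem card_eq : Fintype.card (LineVertex n) = n := Fintype.card_fin n

theorem pos_lt (x : LineVertex n) : x.pos < n := Fin.is_lt x

theorem pos_injective : Function.Injective (pos : LineVertex n → ℕ) := Fin.val_injective

theorem pos_add_length {x y : LineVertex n} (p : Path x y) : x.pos + p.length = y.pos := by
  induction p with
  | nil => rfl
  | cons p α ih =>
    have := α.down
    rw [Path.length_cons]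
    omega

theorem exists_path (d : ℕ) {x y : LineVertex n} (hd : x.pos + d = y.pos) :
    ∃ p : Path x y, p.length = d := by
  induction d generalizing y with
  | zero =>
    obtain rfl := pos_injective hd
    exact ⟨Path.nil, rfl⟩
  | succ d ih =>
    have hy := y.pos_lt
    let z : LineVertex n := (⟨x.pos + d, by omega⟩ : Fin n)
    obtain ⟨p, hp⟩ := ih (y := z) rfl
    have hz : z.pos + 1 = y.pos := hd
    exact ⟨p.cons ⟨hz⟩, by rw [Path.length_cons, hp]⟩

instance : ChainQuiver (LineVertex n) where
  hom_subsingleton a b := inferInstanceAs (Subsingleton (PLift _))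
  out_unique α β := pos_injective (α.down.symm.trans β.down)
  in_unique α β := pos_injective (Nat.succ_injective (α.down.trans β.down.symm))
  length_eq_zero c _ := by
    have := pos_add_length c
    omega
  -- On a line, positions increase along a path, so no path is this long.
  exists_cycle {a b} p hp := by
    have h1 := pos_add_length p
    have h2 := b.pos_lt
    rw [card_eq] at hp
    omega

theorem support_eq : (support : LineVertex n × LineVertex n → _) = arcSupport := by
  funext a
  ext x
  constructor
  · rintro ⟨h1, h2⟩
    obtain ⟨u, hu⟩ := exists_path (x.pos - a.1.pos) (x := a.1) (y := x) (by omega)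
    obtain ⟨v, hv⟩ := exists_path (a.2.pos - x.pos) (x := x) (y := a.2) (by omega)
    have := a.2.pos_lt
    exact ⟨u, v, by rw [card_eq]; omega⟩
  · rintro ⟨u, v, -⟩
    have h1 := pos_add_length u
    have h2 := pos_add_length v
    exact ⟨by omega, by omega⟩

theorem inner_eq : (inner : LineVertex n × LineVertex n → _) = arcInner := by
  funext a
  ext x
  simp only [arcInner, ← support_eq, inner, support, Set.mem_ofPred_eq, ne_eq,
    ← pos_injective.eq_iff]
  omega

theorem exists_short_path_iff {h : ℕ} (hh : 1 ≤ h) (a : LineVertex n × LineVertex n) :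
    (∃ q : Path a.1 a.2, q.length < Fintype.card (LineVertex n) ∧ q.length < h) ↔
      a.1.pos ≤ a.2.pos ∧ a.2.pos - a.1.pos ≤ min (n - 1) (h - 1) := by
  rw [card_eq]
  have := a.2.pos_lt
  constructor
  · rintro ⟨q, hq, hqh⟩
    have := pos_add_length q
    omega
  · rintro ⟨h1, h2⟩
    obtain ⟨q, hq⟩ := exists_path (a.2.pos - a.1.pos) (x := a.1) (y := a.2) (by omega)
    exact ⟨q, by omega, by omega⟩

end LineVertex

/-! ### The cyclic quiver -/

namespace CircleVertex

variable {n : ℕ}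

open Quiver (Path)

theorem card_eq : Fintype.card (CircleVertex n) = n := Fintype.card_fin n

theorem pos_lt (x : CircleVertex n) : x.pos < n := Fin.is_lt x

theorem pos_injective : Function.Injective (pos : CircleVertex n → ℕ) := Fin.val_injective

theorem pos_add_length {x y : CircleVertex n} (p : Path x y) :
    (x.pos + p.length) % n = y.pos := by
  induction p with
  | nil => exact Nat.mod_eq_of_lt x.pos_lt
  | cons p α ih => rw [Path.length_cons, ← α.down, ← ih, Nat.mod_add_mod, add_assoc]

theorem exists_path (d : ℕ) {x y : CircleVertex n} (hd : (x.pos + d) % n = y.pos) :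
    ∃ p : Path x y, p.length = d := by
  induction d generalizing y with
  | zero =>
    obtain rfl : x = y := pos_injective ((Nat.mod_eq_of_lt x.pos_lt).symm.trans hd)
    exact ⟨Path.nil, rfl⟩
  | succ d ih =>
    let z : CircleVertex n :=
      (⟨(x.pos + d) % n, Nat.mod_lt _ (lt_of_le_of_lt (Nat.zero_le _) x.pos_lt)⟩ : Fin n)
    obtain ⟨p, hp⟩ := ih (y := z) rfl
    have hz : (z.pos + 1) % n = y.pos := by
      rw [← hd, ← add_assoc]
      exact Nat.mod_add_mod _ _ _
    exact ⟨p.cons ⟨hz⟩, by rw [Path.length_cons, hp]⟩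

theorem _root_.Quiver.Path.exists_split {V : Type} [Quiver.{0} V] {a b : V} (p : Path a b) {t : ℕ}
    (ht : t ≤ p.length) :
    ∃ (c : V) (q : Path a c) (r : Path c b), p = q.comp r ∧ q.length = t := by
  induction p with
  | nil => exact ⟨a, Path.nil, Path.nil, rfl, (Nat.le_zero.1 ht).symm⟩
  | cons p α ih =>
    rw [Path.length_cons] at ht
    rcases Nat.le_succ_iff.1 ht with ht | ht
    · obtain ⟨c, q, r, rfl, hq⟩ := ih ht
      exact ⟨c, q, r.cons α, rfl, hq⟩
    · exact ⟨_, p.cons α, Path.nil, rfl, ht.symm⟩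

instance : ChainQuiver (CircleVertex n) where
  hom_subsingleton a b := inferInstanceAs (Subsingleton (PLift _))
  out_unique α β := pos_injective (α.down.symm.trans β.down)
  in_unique {a b c} α β := by
    have h1 : b.pos + 1 ≡ c.pos + 1 [MOD n] := α.down.trans β.down.symm
    have h2 := Nat.ModEq.add_right_cancel' 1 h1
    rw [Nat.ModEq, Nat.mod_eq_of_lt b.pos_lt, Nat.mod_eq_of_lt c.pos_lt] at h2
    exact pos_injective h2
  length_eq_zero {a} c hc := by
    rw [card_eq] at hc
    have h1 : a.pos + c.length ≡ a.pos + 0 [MOD n] := by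
      rw [Nat.ModEq, pos_add_length, add_zero, Nat.mod_eq_of_lt a.pos_lt]
    have h2 := Nat.ModEq.add_left_cancel' _ h1
    rwa [Nat.ModEq, Nat.mod_eq_of_lt hc, Nat.zero_mod] at h2
  exists_cycle {a b} p hp := by
    rw [card_eq] at hp
    -- After exactly `n` steps the path is back at its source.
    obtain ⟨c, q, r, rfl, hq⟩ := p.exists_split hp
    have h1 := pos_add_length q
    rw [hq, Nat.add_mod_right, Nat.mod_eq_of_lt a.pos_lt] at h1
    obtain rfl := pos_injective h1
    exact ⟨q, r, by rw [hq]; exact lt_of_le_of_lt (Nat.zero_le _) a.pos_lt, rfl⟩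

theorem dist_eq (x y : CircleVertex n) :
    x.dist y = if x.pos ≤ y.pos then y.pos - x.pos else y.pos + n - x.pos := by
  have hx := x.pos_lt
  have hy := y.pos_lt
  rw [dist]
  split_ifs with hxy
  · rw [show y.pos + n - x.pos = y.pos - x.pos + n by omega, Nat.add_mod_right,
      Nat.mod_eq_of_lt (by omega)]
  · rw [Nat.mod_eq_of_lt (by omega)]

theorem dist_lt (x y : CircleVertex n) : x.dist y < n :=
  Nat.mod_lt _ (lt_of_le_of_lt (Nat.zero_le _) x.pos_lt)

theorem exists_path_dist (x y : CircleVertex n) : ∃ p : Path x y, p.length = x.dist y := by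
  apply exists_path
  have hx := x.pos_lt
  rw [dist, Nat.add_mod_mod, show x.pos + (y.pos + n - x.pos) = y.pos + n by omega,
    Nat.add_mod_right, Nat.mod_eq_of_lt y.pos_lt]

theorem length_eq_dist {x y : CircleVertex n} (p : Path x y) (hp : p.length < n) :
    p.length = x.dist y := by
  obtain ⟨q, hq⟩ := exists_path_dist x y
  rw [← hq, Path.eq_of_length_lt_card (p := p) (q := q) (by rwa [card_eq])
    (by rw [card_eq, hq]; exact dist_lt x y)]

theorem support_eq : (support : CircleVertex n × CircleVertex n → _) = arcSupport := by
  funext a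
  ext x
  -- The point `x` is met no later than `a.2` exactly when the way from `a.1` through `x` to `a.2`
  -- stays below one full turn.
  have key : a.1.dist x ≤ a.1.dist a.2 ↔ a.1.dist x + x.dist a.2 < n := by
    have h1 := a.1.pos_lt
    have h2 := a.2.pos_lt
    have h3 := x.pos_lt
    simp only [dist_eq]
    split_ifs <;> omega
  rw [support, Set.mem_ofPred_eq, key]
  constructor
  · intro hlt
    obtain ⟨u, hu⟩ := exists_path_dist a.1 x
    obtain ⟨v, hv⟩ := exists_path_dist x a.2
    exact ⟨u, v, by rwa [card_eq, hu, hv]⟩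
  · rintro ⟨u, v, huv⟩
    rw [card_eq] at huv
    rwa [← length_eq_dist u (by omega), ← length_eq_dist v (by omega)]

theorem inner_eq : (inner : CircleVertex n × CircleVertex n → _) = arcInner := by
  funext a
  ext x
  simp only [arcInner, ← support_eq, inner, support, Set.mem_ofPred_eq, ne_eq,
    ← pos_injective.eq_iff]
  have h1 := a.1.pos_lt
  have h2 := a.2.pos_lt
  have h3 := x.pos_lt
  simp only [dist_eq]
  split_ifs <;> omega

theorem exists_short_path_iff {h : ℕ} (hh : 1 ≤ h) (a : CircleVertex n × CircleVertex n) :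
    (∃ q : Path a.1 a.2, q.length < Fintype.card (CircleVertex n) ∧ q.length < h) ↔
      a.1.dist a.2 ≤ min (n - 1) (h - 1) := by
  rw [card_eq]
  have := dist_lt a.1 a.2
  constructor
  · rintro ⟨q, hq, hqh⟩
    have := length_eq_dist q hq
    omega
  · intro hle
    obtain ⟨q, hq⟩ := exists_path_dist a.1 a.2
    exact ⟨q, by omega, by omega⟩

end CircleVertex

/-! ### Configurations in terms of paths, and the theorem for the line and the circle -/

theorem LineConfig.mem_range_arcs_iff {n h : ℕ} (hh : 1 ≤ h)
    (C : Set (LineVertex n × LineVertex n)) :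
    C ∈ Set.range (LineConfig.arcs : LineConfig n h → _) ↔
      (∀ a ∈ C, ∃ q : Quiver.Path a.1 a.2,
        q.length < Fintype.card (LineVertex n) ∧ q.length < h) ∧
        C.Pairwise (NonCrossing arcSupport arcInner) := by
  simp only [LineVertex.exists_short_path_iff hh, ← LineVertex.support_eq, ← LineVertex.inner_eq]
  constructor
  · rintro ⟨c, rfl⟩
    exact ⟨fun a ha => ⟨c.ordered a ha, c.length_le a ha⟩, c.nonCrossing⟩
  · rintro ⟨h1, h2⟩
    exact ⟨⟨C, fun a ha => (h1 a ha).1, fun a ha => (h1 a ha).2, h2⟩, rfl⟩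

theorem CircleConfig.mem_range_arcs_iff {n h : ℕ} (hh : 1 ≤ h)
    (C : Set (CircleVertex n × CircleVertex n)) :
    C ∈ Set.range (CircleConfig.arcs : CircleConfig n h → _) ↔
      (∀ a ∈ C, ∃ q : Quiver.Path a.1 a.2,
        q.length < Fintype.card (CircleVertex n) ∧ q.length < h) ∧
        C.Pairwise (NonCrossing arcSupport arcInner) := by
  simp only [CircleVertex.exists_short_path_iff hh, ← CircleVertex.support_eq,
    ← CircleVertex.inner_eq]
  constructor
  · rintro ⟨c, rfl⟩
    exact ⟨c.length_le, c.nonCrossing⟩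
  · rintro ⟨h1, h2⟩
    exact ⟨⟨C, h1, h2⟩, rfl⟩

theorem corollary5p10 (K : Type u) [Field K] [IsAlgClosed K] (n h : ℕ) (hn : 1 ≤ n) (hh : 1 < h) :
    (∃ e : Uniloc (LineAlgebra K n h) ≃ LineConfig n h,
      ∀ L : UnivLoc (LineAlgebra K n h), (e L.epiclass).arcs = L.arcs) ∧
    (∃ e : Uniloc (CircleAlgebra K n h) ≃ CircleConfig n h,
      ∀ L : UnivLoc (CircleAlgebra K n h), (e L.epiclass).arcs = L.arcs) :=
  ⟨exists_equiv_config hh.le LineConfig.arcs (fun _ _ => LineConfig.ext)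
      (LineConfig.mem_range_arcs_iff hh.le),
    exists_equiv_config hh.le CircleConfig.arcs (fun _ _ => CircleConfig.ext)
      (CircleConfig.mem_range_arcs_iff hh.le)⟩
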